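/- Let $V$ be a $k$-dimensional complex vector space with a nondegenerate symmetric bilinear form $(\,,)$. Put $$\mathfrak t=\{X\in\mathfrak{gl}(V): (Xu,v)=-(u,Xv)\ \forall u,v\},\qquad \mathfrak p=\{X\in\mathfrak{gl}(V): (Xu,v)=(u,Xv)\ \forall u,v\},$$ regarded as affine spaces over $\mathbb C$, and let $m\colon\mathfrak p\times\mathfrak p\to\mathfrak t$, $(B_1,B_2)\mapsto[B_1,B_2]$, be the commutator morphism. For $B\in\mathfrak p$ let $\mathfrak p^B=\{A\in\mathfrak p:[A,B]=0\}$, and let $\mathfrak p_k=\{B\in\mathfrak p:\dim\mathfrak p^B=k\}$. Let $\pi_1,\pi_2\colon\mathfrak p\times\mathfrak p\to\mathfrak p$ be the two projections. Then $U:=\pi_1^{-1}(\mathfrak p_k)\cup\pi_2^{-1}(\mathfrak p_k)$ is (the set of closed points of) a Zariski open subscheme of $\mathfrak p\times\mathfrak p$, and for every $X\in\mathfrak t$: (1) The morphism $m$ is smooth at every point of $m^{-1}(X)\cap U$; in fact $m|_U\colon U\to\mathfrak t$ is a smooth morphism. Consequently the open subscheme $m^{-1}(X)\cap U$ of the scheme-theoretic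 fibre $m^{-1}(X)$ is smooth over $\mathbb C$. (2) The complement $m^{-1}(X)\setminus U$ has codimension at least $2$ in $m^{-1}(X)$ (the empty set being regarded as having codimension $\infty$). -/

import Mathlib

open CategoryTheory AlgebraicGeometry TopologicalSpace

universe u

noncomputable section

namespace OrthogonalCommutator

section AffineSpace

variable (E : Type u) [AddCommGroup E] [Module ℂ E]

/-- The coordinate ring `ℂ[E]` of polynomial functions on a finite-dimensional complex vector
space `E`: the algebra of functions generated by the linear forms. -/
def coordRing : Subalgebra ℂ (E → ℂ) :=
  Algebra.adjoin ℂ (Set.range fun φ : Module.Dual ℂ E => (φ : E → ℂ))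

/-- The vector space `E`, regarded as a scheme (an affine space over `ℂ`). -/
def affine : Scheme.{u} := Spec (CommRingCat.of (coordRing E))

variable {E}

/-- Evaluation of polynomial functions at a vector. -/
def evalAt (v : E) : coordRing E →+* ℂ :=
  (Pi.evalRingHom (fun _ : E => ℂ) v).comp (coordRing E).subtype

/-- The closed point of the scheme `affine E` given by a vector. -/
def pt (v : E) : affine E :=
  (⟨RingHom.ker (evalAt v), RingHom.ker_isPrime _⟩ : PrimeSpectrum (coordRing E))

variable {F : Type u} [AddCommGroup F] [Module ℂ F]

/-- A map of vector spaces is polynomial if its composition with every linear form is a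
polynomial function. -/
def IsPolynomialMap (f : E → F) : Prop :=
  ∀ φ : Module.Dual ℂ F, (fun v => φ (f v)) ∈ coordRing E

theorem IsPolynomialMap.comp_mem {f : E → F} (hf : IsPolynomialMap f) {g : F → ℂ}
    (hg : g ∈ coordRing F) : (fun v => g (f v)) ∈ coordRing E := by
  induction hg using Algebra.adjoin_induction with
  | mem g hg => obtain ⟨φ, rfl⟩ := hg; exact hf φ
  | algebraMap r => exact (coordRing E).algebraMap_mem r
  | add g h _ _ hg hh => exact (coordRing E).add_mem hg hh
  | mul g h _ _ hg hh => exact (coordRing E).mul_mem hg hh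

/-- The comorphism `g ↦ g ∘ f` of a polynomial map `f`. -/
def comorphism (f : E → F) (hf : IsPolynomialMap f) : coordRing F →+* coordRing E where
  toFun g := ⟨fun v => (g : F → ℂ) (f v), hf.comp_mem g.2⟩
  map_one' := rfl
  map_mul' _ _ := rfl
  map_zero' := rfl
  map_add' _ _ := rfl

/-- The morphism of schemes given by a polynomial map of vector spaces. -/
def affineMap (f : E → F) (hf : IsPolynomialMap f) : affine E ⟶ affine F :=
  Spec.map (CommRingCat.ofHom (comorphism f hf))

theorem bilin_mem_coordRing [FiniteDimensional ℂ E] (β : E →ₗ[ℂ] E →ₗ[ℂ] ℂ) :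
    (fun x : E × E => β x.1 x.2) ∈ coordRing (E × E) := by
  let e := Module.finBasis ℂ E
  have h : (fun x : E × E => β x.1 x.2) =
      ∑ i, (fun x : E × E => ((e.coord i).comp (LinearMap.fst ℂ E E)) x) *
        (fun x : E × E => ((β (e i)).comp (LinearMap.snd ℂ E E)) x) := by
    funext x
    have hx : β x.1 = ∑ i, e.repr x.1 i • β (e i) := by
      conv_lhs => rw [← e.sum_repr x.1]
      rw [map_sum]
      simp only [map_smul]
    simp [hx]
  rw [h]
  exact (coordRing (E × E)).sum_mem fun i _ => (coordRing (E × E)).mul_mem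
    (Algebra.subset_adjoin ⟨_, rfl⟩) (Algebra.subset_adjoin ⟨_, rfl⟩)

end AffineSpace

/-- The codimension of a closed subset `Z` of a topological space `Y`: the infimum, over the
irreducible closed `T ⊆ Z`, of the supremum of lengths of chains `T = T₀ ⊂ T₁ ⊂ ⋯ ⊂ Tₙ` of
irreducible closed subsets of `Y`. It is `⊤` if `Z` is empty. -/
def codimension {Y : Type*} [TopologicalSpace Y] (Z : Set Y) : ℕ∞ :=
  ⨅ (T : IrreducibleCloseds Y) (_ : (T : Set Y) ⊆ Z), Order.coheight T

section Orthogonal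

variable {V : Type u} [AddCommGroup V] [Module ℂ V] (b : LinearMap.BilinForm ℂ V)

/-- `𝔱 = {X ∈ 𝔤𝔩(V) | (X u, v) = -(u, X v)}`. -/
abbrev tSpace : Submodule ℂ (Module.End ℂ V) := b.skewAdjointSubmodule

/-- `𝔭 = {X ∈ 𝔤𝔩(V) | (X u, v) = (u, X v)}`. -/
abbrev pSpace : Submodule ℂ (Module.End ℂ V) := b.selfAdjointSubmodule

/-- `𝔭^B = {A ∈ 𝔭 | [A, B] = 0}`. -/
def pCentralizer (B : Module.End ℂ V) : Submodule ℂ (Module.End ℂ V) where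
  carrier := {A | A ∈ pSpace b ∧ A * B - B * A = 0}
  zero_mem' := ⟨zero_mem _, by simp⟩
  add_mem' := by
    rintro A A' ⟨hA, h⟩ ⟨hA', h'⟩
    refine ⟨add_mem hA hA', ?_⟩
    rw [add_mul, mul_add, add_sub_add_comm, h, h', add_zero]
  smul_mem' := by
    rintro c A ⟨hA, h⟩
    refine ⟨Submodule.smul_mem _ c hA, ?_⟩
    rw [smul_mul_assoc, mul_smul_comm, ← smul_sub, h, smul_zero]

/-- `𝔭_l = {B ∈ 𝔭 | dim 𝔭^B = l}`. -/
def pStratum (l : ℕ) : Set (pSpace b) :=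
  {B | Module.finrank ℂ (pCentralizer b (B : Module.End ℂ V)) = l}

theorem commutator_mem {B₁ B₂ : Module.End ℂ V} (h₁ : B₁ ∈ pSpace b) (h₂ : B₂ ∈ pSpace b) :
    B₁ * B₂ - B₂ * B₁ ∈ tSpace b := by
  rw [LinearMap.mem_skewAdjointSubmodule]
  rw [LinearMap.mem_selfAdjointSubmodule] at h₁ h₂
  intro x y
  have h₁' : ∀ x y, b (B₁ x) y = b x (B₁ y) := h₁
  have h₂' : ∀ x y, b (B₂ x) y = b x (B₂ y) := h₂
  simp [h₁', h₂']

/-- The commutator map `m : 𝔭 × 𝔭 → 𝔱`, `(B₁, B₂) ↦ [B₁, B₂]`. -/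
def commutator (x : pSpace b × pSpace b) : tSpace b :=
  ⟨(x.1 : Module.End ℂ V) * x.2 - x.2 * x.1, commutator_mem b x.1.2 x.2.2⟩

theorem isPolynomialMap_commutator [FiniteDimensional ℂ V] :
    IsPolynomialMap (commutator b) := by
  intro φ
  exact bilin_mem_coordRing (LinearMap.mk₂ ℂ (fun B₁ B₂ => φ (commutator b (B₁, B₂)))
    (fun A A' B => by
      rw [← map_add]; congr 1; ext1; simp [commutator, add_mul, mul_add]; abel)
    (fun c A B => by
      rw [← map_smul]; congr 1; ext1; simp [commutator, smul_sub])
    (fun A B B' => by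
      rw [← map_add]; congr 1; ext1; simp [commutator, add_mul, mul_add]; abel)
    (fun c A B => by
      rw [← map_smul]; congr 1; ext1; simp [commutator, smul_sub]))

/-- The commutator map, as a morphism of schemes from the affine space `𝔭 × 𝔭` to the affine
space `𝔱`. -/
def commutatorMor [FiniteDimensional ℂ V] : affine (pSpace b × pSpace b) ⟶ affine (tSpace b) :=
  affineMap (commutator b) (isPolynomialMap_commutator b)

end Orthogonal

end OrthogonalCommutator

end

namespace OrthogonalCommutator

open Matrix

section SymmetricMatrices

variable (n R : Type*) [CommRing R]

/-- The module of symmetric matrices. -/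
def symMatrix : Submodule R (Matrix n n R) where
  carrier := {A | Aᵀ = A}
  zero_mem' := transpose_zero
  add_mem' := by
    intro A B hA hB
    rw [Set.mem_ofPred_eq] at *
    rw [transpose_add, hA, hB]
  smul_mem' := by
    intro c A hA
    rw [Set.mem_ofPred_eq] at *
    rw [transpose_smul, hA]

/-- The module of skew-symmetric matrices. -/
def skewMatrix : Submodule R (Matrix n n R) where
  carrier := {A | Aᵀ = -A}
  zero_mem' := by simp
  add_mem' := by
    intro A B hA hB
    rw [Set.mem_ofPred_eq] at *
    rw [transpose_add, hA, hB, neg_add]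
  smul_mem' := by
    intro c A hA
    rw [Set.mem_ofPred_eq] at *
    rw [transpose_smul, hA, smul_neg]

variable {n R}

@[simp] theorem mem_symMatrix {A : Matrix n n R} : A ∈ symMatrix n R ↔ Aᵀ = A := Iff.rfl

@[simp] theorem mem_skewMatrix {A : Matrix n n R} : A ∈ skewMatrix n R ↔ Aᵀ = -A := Iff.rfl

variable [Fintype n]

theorem commutator_mem_skewMatrix {A B : Matrix n n R} (hA : A ∈ symMatrix n R)
    (hB : B ∈ symMatrix n R) : A * B - B * A ∈ skewMatrix n R := by
  rw [mem_symMatrix] at hA hB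
  rw [mem_skewMatrix, transpose_sub, transpose_mul, transpose_mul, hA, hB, neg_sub]

/-- `[B, ·]` maps the symmetric matrices onto the skew-symmetric ones. -/
def AdSurjective (B : Matrix n n R) : Prop :=
  ∀ Z ∈ skewMatrix n R, ∃ A ∈ symMatrix n R, B * A - A * B = Z

end SymmetricMatrices

section Field

variable {n L : Type*} [Field L]

theorem single_add_single_mem_symMatrix [DecidableEq n] (i j : n) :
    (single i j 1 + single j i 1 : Matrix n n L) ∈ symMatrix n L := by
  rw [mem_symMatrix, transpose_add, transpose_single, transpose_single, add_comm]

theorem trace_mul_single_add [Fintype n] [DecidableEq n] (A : Matrix n n L) (i j : n) :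
    trace (A * (single i j 1 + single j i 1)) = A j i + A i j := by
  rw [mul_add, trace_add, trace_mul_single, trace_mul_single]; simp

variable [CharZero L]

theorem apply_self_eq_zero_of_mem_skewMatrix {A : Matrix n n L} (hA : A ∈ skewMatrix n L) (i : n) :
    A i i = 0 := by
  have h := congr_fun (congr_fun (mem_skewMatrix.1 hA) i) i
  rw [transpose_apply, Matrix.neg_apply] at h
  exact self_eq_neg.1 h

variable (n L) in
/-- A symmetric matrix is determined by its off-diagonal part, which can be made skew-symmetric,
and its diagonal. -/
def symMatrixEquiv [LinearOrder n] : symMatrix n L ≃ₗ[L] skewMatrix n L × (n → L) where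
  toFun A := (⟨of fun i j => if i < j then A.1 i j else if j < i then -A.1 i j else 0, by
      ext i j
      have h := congr_fun (congr_fun (mem_symMatrix.1 A.2) i) j
      rw [transpose_apply] at h
      rcases lt_trichotomy i j with hij | rfl | hij
      · simp [hij, not_lt_of_gt hij, h]
      · simp
      · simp [hij, not_lt_of_gt hij, h]⟩, fun i => A.1 i i)
  map_add' A B := by
    ext i j
    · rcases lt_trichotomy i j with hij | rfl | hij
      · simp [hij]
      · simp
      · simpa [hij, not_lt_of_gt hij] using add_comm _ _
    · simp
  map_smul' c A := by
    ext i j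
    · rcases lt_trichotomy i j with hij | rfl | hij
      · simp [hij]
      · simp
      · simp [hij, not_lt_of_gt hij]
    · simp
  invFun S := ⟨of fun i j => if i < j then S.1.1 i j else if j < i then -S.1.1 i j else S.2 i, by
      ext i j
      have h := congr_fun (congr_fun (mem_skewMatrix.1 S.1.2) i) j
      rw [transpose_apply, Matrix.neg_apply] at h
      rcases lt_trichotomy i j with hij | rfl | hij
      · simp [hij, not_lt_of_gt hij, h]
      · simp
      · simp [hij, not_lt_of_gt hij, h]⟩
  left_inv A := by
    ext i j
    have h := congr_fun (congr_fun (mem_symMatrix.1 A.2) i) j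
    rcases lt_trichotomy i j with hij | rfl | hij
    · simp [hij]
    · simp
    · simp [hij, not_lt_of_gt hij]
  right_inv S := by
    ext i j
    · rcases lt_trichotomy i j with hij | rfl | hij
      · simp [hij]
      · simp [apply_self_eq_zero_of_mem_skewMatrix S.1.2]
      · simp [hij, not_lt_of_gt hij]
    · simp

variable (n L) in
theorem isCompl_symMatrix_skewMatrix : IsCompl (symMatrix n L) (skewMatrix n L) := by
  refine ⟨Submodule.disjoint_def.2 fun A hA hA' => ?_, codisjoint_iff_le_sup.2 fun A _ => ?_⟩
  · rw [mem_symMatrix] at hA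
    rw [mem_skewMatrix, hA] at hA'
    ext i j
    exact self_eq_neg.1 (congr_fun (congr_fun hA' i) j)
  · refine Submodule.mem_sup.2 ⟨(2⁻¹ : L) • (A + Aᵀ), ?_, (2⁻¹ : L) • (A - Aᵀ), ?_, ?_⟩
    · rw [mem_symMatrix, transpose_smul, transpose_add, transpose_transpose, add_comm]
    · rw [mem_skewMatrix, transpose_smul, ← smul_neg, transpose_sub, transpose_transpose, neg_sub]
    · rw [← smul_add, add_add_sub_cancel, ← two_smul L A, smul_smul, inv_mul_cancel₀ two_ne_zero,
        one_smul]

variable (n L) in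
theorem finrank_symMatrix [Fintype n] [LinearOrder n] :
    Module.finrank L (symMatrix n L) = Module.finrank L (skewMatrix n L) + Fintype.card n := by
  rw [(symMatrixEquiv n L).finrank_eq, Module.finrank_prod, Module.finrank_fintype_fun_eq_card]

variable (n L) in
theorem two_mul_finrank_symMatrix [Fintype n] [LinearOrder n] :
    2 * Module.finrank L (symMatrix n L) = Fintype.card n ^ 2 + Fintype.card n := by
  have h := Submodule.finrank_add_eq_of_isCompl (isCompl_symMatrix_skewMatrix n L)
  rw [Module.finrank_matrix, Module.finrank_self, mul_one, ← pow_two] at h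
  have := finrank_symMatrix n L
  omega

variable [Fintype n] [DecidableEq n]

theorem eq_zero_of_forall_trace_mul_eq_zero {G : Matrix n n L} (hG : G ∈ symMatrix n L)
    (h : ∀ A ∈ symMatrix n L, trace (G * A) = 0) : G = 0 := by
  ext i j
  have h1 := h _ (single_add_single_mem_symMatrix i j)
  have h2 := congr_fun (congr_fun (mem_symMatrix.1 hG) i) j
  rw [trace_mul_single_add, ← transpose_apply G, h2, ← two_mul] at h1
  simpa using h1

/-- If `[B, ·]` is not surjective onto the skew-symmetric matrices, then `B` commutes with a
nonzero skew-symmetric matrix. -/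
theorem exists_skewMatrix_commute {B : Matrix n n L} (hB : B ∈ symMatrix n L)
    (h : ¬ AdSurjective B) : ∃ Y ∈ skewMatrix n L, Y ≠ 0 ∧ Commute Y B := by
  simp only [AdSurjective, not_forall] at h
  obtain ⟨Z, hZ, hZB⟩ := h
  let ad : Matrix n n L →ₗ[L] Matrix n n L := LinearMap.mulLeft L B - LinearMap.mulRight L B
  have hZ' : Z ∉ (symMatrix n L).map ad := by
    rintro ⟨A, hA, rfl⟩
    exact hZB ⟨A, hA, rfl⟩
  obtain ⟨f, hf, hfW⟩ := Submodule.exists_le_ker_of_notMem hZ'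
  let F : Matrix n n L := of fun i j => f (single j i 1)
  have hF : ∀ A, f A = trace (F * A) := by
    intro A
    conv_lhs => rw [matrix_eq_sum_single A]
    rw [map_sum, trace]
    simp only [map_sum, diag_apply, mul_apply]
    rw [Finset.sum_comm]
    refine Finset.sum_congr rfl fun j _ => Finset.sum_congr rfl fun i _ => ?_
    have : (single i j (A i j) : Matrix n n L) = A i j • single i j 1 := by simp
    rw [this, map_smul, smul_eq_mul, mul_comm]
    rfl
  have hY : ∀ S ∈ skewMatrix n L, trace ((F - Fᵀ) * S) = 2 * f S := by
    intro S hS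
    rw [sub_mul, trace_sub, ← trace_transpose (Fᵀ * S), transpose_mul, transpose_transpose,
      mem_skewMatrix.1 hS, neg_mul, trace_neg, trace_mul_comm S F, hF]
    ring
  have hYs : F - Fᵀ ∈ skewMatrix n L := by simp
  refine ⟨F - Fᵀ, hYs, ?_, ?_⟩
  · intro h0
    have := hY Z hZ
    rw [h0, zero_mul, trace_zero, eq_comm] at this
    exact hf ((mul_eq_zero.1 this).resolve_left two_ne_zero)
  · generalize F - Fᵀ = Y at hY hYs
    rw [commute_iff_eq, ← sub_eq_zero]
    refine eq_zero_of_forall_trace_mul_eq_zero ?_ fun A hA => ?_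
    · rw [mem_symMatrix, transpose_sub, transpose_mul, transpose_mul, mem_symMatrix.1 hB,
        mem_skewMatrix.1 hYs, mul_neg, neg_mul, sub_neg_eq_add, neg_add_eq_sub]
    · have h1 := hY _ (commutator_mem_skewMatrix hB hA)
      rw [show f (B * A - A * B) = 0 from hfW ⟨A, hA, rfl⟩, mul_zero] at h1
      rw [← h1, mul_sub, sub_mul, trace_sub, trace_sub, mul_assoc, mul_assoc B Y A,
        trace_mul_comm B, mul_assoc Y A B]

end Field

section SelfAdjoint

variable {n L : Type*} [Field L] [Fintype n] {f y : Module.End L (n → L)}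

theorem aeval_dotProduct (hf : ∀ u v, f u ⬝ᵥ v = u ⬝ᵥ f v) (p : Polynomial L) (u v : n → L) :
    Polynomial.aeval f p u ⬝ᵥ v = u ⬝ᵥ Polynomial.aeval f p v := by
  induction p using Polynomial.induction_on' generalizing u v with
  | add p q hp hq => simp [hp, hq]
  | monomial k a =>
    have hk : ∀ u v, (f ^ k) u ⬝ᵥ v = u ⬝ᵥ (f ^ k) v := by
      induction k with
      | zero => simp
      | succ k ih =>
        intro u v
        rw [pow_succ, Module.End.mul_apply, ih, hf, ← Module.End.mul_apply, ← pow_succ',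
          ← pow_succ]
    simp [Polynomial.aeval_monomial, hk]

theorem dotProduct_eq_zero_of_mem_maxGenEigenspace (hf : ∀ u v, f u ⬝ᵥ v = u ⬝ᵥ f v) {a c : L}
    (hac : a ≠ c) {u v : n → L} (hu : u ∈ f.maxGenEigenspace a)
    (hv : v ∈ f.maxGenEigenspace c) : u ⬝ᵥ v = 0 := by
  obtain ⟨k, hk⟩ := (Module.End.mem_maxGenEigenspace f a u).1 hu
  obtain ⟨l, hl⟩ := (Module.End.mem_maxGenEigenspace f c v).1 hv
  have hco : IsCoprime ((Polynomial.X - Polynomial.C a) ^ k) ((Polynomial.X - Polynomial.C c) ^ l) :=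
    (Polynomial.pairwise_coprime_X_sub_C Function.injective_id hac).pow
  obtain ⟨p, q, hpq⟩ := hco
  have key : ∀ (d : L) (m : ℕ), Polynomial.aeval f ((Polynomial.X - Polynomial.C d) ^ m) =
      (f - d • 1) ^ m := by
    intro d m
    simp [Algebra.algebraMap_eq_smul_one]
  have hv' : v = Polynomial.aeval f ((Polynomial.X - Polynomial.C a) ^ k) (Polynomial.aeval f p v) +
      Polynomial.aeval f q (Polynomial.aeval f ((Polynomial.X - Polynomial.C c) ^ l) v) := by
    rw [← Module.End.mul_apply, ← Module.End.mul_apply, ← map_mul, ← map_mul, ← LinearMap.add_apply,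
      ← map_add, mul_comm _ p, hpq, map_one, Module.End.one_apply]
  rw [hv', key c l, hl, map_zero, add_zero, ← aeval_dotProduct hf, key a k, hk, zero_dotProduct]

variable [IsAlgClosed L]

theorem eq_zero_of_forall_mem_maxGenEigenspace (hf : ∀ u v, f u ⬝ᵥ v = u ⬝ᵥ f v) {a : L}
    {u : n → L} (hu : u ∈ f.maxGenEigenspace a)
    (h : ∀ v ∈ f.maxGenEigenspace a, u ⬝ᵥ v = 0) : u = 0 := by
  classical
  refine dotProduct_eq_zero u fun v => ?_
  have hv : v ∈ ⨆ μ, f.maxGenEigenspace μ := by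
    rw [Module.End.iSup_maxGenEigenspace_eq_top]; trivial
  induction hv using Submodule.iSup_induction' with
  | mem c v hv =>
    by_cases hac : a = c
    · exact h v (hac ▸ hv)
    · exact dotProduct_eq_zero_of_mem_maxGenEigenspace hf hac hu hv
  | zero => exact dotProduct_zero u
  | add v w _ _ hv hw => rw [dotProduct_add, hv, hw, add_zero]

/-- A skew-adjoint endomorphism commuting with the self-adjoint `f` vanishes on a generalized
eigenspace of `f` generated by one vector `v` and its image under `f`. -/
theorem eq_zero_on_of_le_span_pair [CharZero L] (hf : ∀ u v, f u ⬝ᵥ v = u ⬝ᵥ f v)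
    (hy : ∀ u v, y u ⬝ᵥ v = -(u ⬝ᵥ y v)) (hyf : Commute f y) {a : L} {v : n → L}
    (hv : v ∈ f.maxGenEigenspace a) (hspan : f.maxGenEigenspace a ≤ Submodule.span L {v, f v})
    {w : n → L} (hw : w ∈ f.maxGenEigenspace a) : y w = 0 := by
  have hmaps := Module.End.mapsTo_maxGenEigenspace_of_comm hyf a
  obtain ⟨s, t, hst⟩ := Submodule.mem_span_pair.1 (hspan (hmaps hv))
  have hcomm : ∀ x, y (f x) = f (y x) := fun x => (LinearMap.congr_fun hyf.eq x).symm
  have hpol : ∀ x ∈ f.maxGenEigenspace a, y x = s • x + t • f x := by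
    intro x hx
    obtain ⟨c, d, rfl⟩ := Submodule.mem_span_pair.1 (hspan hx)
    rw [map_add, map_smul, map_smul, hcomm, ← hst]
    simp only [map_add, map_smul, smul_add]
    module
  refine eq_zero_of_forall_mem_maxGenEigenspace hf (hmaps hw) fun x hx => ?_
  have h1 : y w ⬝ᵥ x = w ⬝ᵥ y x := by
    rw [hpol w hw, hpol x hx]
    simp [hf]
  rw [hy] at h1
  rw [hy]
  exact neg_eq_zero.2 (neg_eq_self.1 h1)

theorem exists_maxGenEigenspace_ne_zero (hy : y ≠ 0) :
    ∃ a, ∃ w ∈ f.maxGenEigenspace a, y w ≠ 0 := by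
  by_contra! h
  refine hy (LinearMap.ext fun v => ?_)
  have hv : v ∈ ⨆ μ, f.maxGenEigenspace μ := by
    rw [Module.End.iSup_maxGenEigenspace_eq_top]; trivial
  induction hv using Submodule.iSup_induction' with
  | mem c v hv => exact h c v hv
  | zero => exact map_zero y
  | add v w _ _ hv hw => rw [map_add, map_add, hv, hw]

theorem exists_isotropic_of_linearIndependent [CharZero L] {u v : n → L}
    (h : LinearIndependent L ![u, v]) : ∃ e ∈ Submodule.span L {u, v}, e ≠ 0 ∧ e ⬝ᵥ e = 0 := by
  rw [LinearIndependent.pair_iff] at h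
  by_cases hv : v ⬝ᵥ v = 0
  · refine ⟨v, Submodule.subset_span (by simp), fun h0 => ?_, hv⟩
    have := h 0 1 (by simp [h0])
    simp at this
  · obtain ⟨t, ht⟩ := exists_quadratic_eq_zero hv (b := 2 * (u ⬝ᵥ v)) (c := u ⬝ᵥ u)
      (IsAlgClosed.exists_eq_mul_self _)
    refine ⟨u + t • v, Submodule.mem_span_pair.2 ⟨1, t, by simp⟩, fun h0 => ?_, ?_⟩
    · have := h 1 t (by simpa using h0)
      simp at this
    · rw [← ht]
      simp only [add_dotProduct, dotProduct_add, smul_dotProduct, dotProduct_smul, smul_eq_mul,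
        dotProduct_comm v u]
      ring

theorem exists_isotropic_eigenvector [CharZero L] (hf : ∀ u v, f u ⬝ᵥ v = u ⬝ᵥ f v)
    (hy : ∀ u v, y u ⬝ᵥ v = -(u ⬝ᵥ y v)) (hyf : Commute f y) (hy0 : y ≠ 0) :
    ∃ (a : L) (e : n → L), e ≠ 0 ∧ f e = a • e ∧ e ⬝ᵥ e = 0 := by
  by_contra! hiso
  obtain ⟨a, w, hw, hyw⟩ := exists_maxGenEigenspace_ne_zero (f := f) hy0
  have hgen : ∀ v ∈ f.maxGenEigenspace a, f v = a • v := by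
    have hpow : ∀ (k : ℕ) (v : n → L), ((f - a • 1) ^ (k + 1)) v = 0 → f v = a • v := by
      intro k
      induction k with
      | zero =>
        intro v hv
        simpa [sub_eq_zero] using hv
      | succ k ih =>
        intro v hv
        have h1 : f ((f - a • 1) v) = a • (f - a • 1) v := ih _ (by
          rw [← Module.End.mul_apply, ← pow_succ]; exact hv)
        by_contra hne
        refine hiso a ((f - a • 1) v) (fun h0 => hne (by simpa [sub_eq_zero] using h0)) h1 ?_
        have h2 : (f - a • 1) ((f - a • 1) v) = 0 := by
          rw [LinearMap.sub_apply, h1]; simp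
        have h3 : ∀ u v, (f - a • 1) u ⬝ᵥ v = u ⬝ᵥ (f - a • 1) v := by
          intro u v
          simp [hf]
        rw [h3, h2, dotProduct_zero]
    intro v hv
    obtain ⟨k, hk⟩ := (Module.End.mem_maxGenEigenspace f a v).1 hv
    exact hpow k v (by rw [pow_succ', Module.End.mul_apply, hk, map_zero])
  refine hyw (eq_zero_on_of_le_span_pair hf hy hyf hw (fun v hv => ?_) hw)
  by_contra hvw
  have hw0 : w ≠ 0 := fun h0 => hyw (by rw [h0, map_zero])
  have hli : LinearIndependent L ![w, v] := by
    rw [LinearIndependent.pair_iff' hw0]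
    rintro c rfl
    exact hvw (Submodule.smul_mem _ c (Submodule.subset_span (by simp)))
  obtain ⟨e, he, he0, hee⟩ := exists_isotropic_of_linearIndependent hli
  refine hiso a e he0 (hgen e ?_) hee
  refine Submodule.span_le.2 ?_ he
  rintro x (rfl | rfl)
  · exact hw
  · exact hv

end SelfAdjoint

section CountEigenvalues

variable {n L : Type*} [Field L] [Fintype n] {f y : Module.End L (n → L)}

theorem sum_finrank_maxGenEigenspace [IsAlgClosed L] [DecidableEq L] (f : Module.End L (n → L)) :
    ∑ a ∈ f.charpoly.roots.toFinset, Module.finrank L (f.maxGenEigenspace a) = Fintype.card n := by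
  simp_rw [LinearMap.finrank_maxGenEigenspace_eq, ← Polynomial.count_roots]
  rw [Multiset.toFinset_sum_count_eq, IsAlgClosed.card_roots_eq_natDegree,
    LinearMap.charpoly_natDegree, Module.finrank_fintype_fun_eq_card]

theorem mem_roots_charpoly_iff [DecidableEq L] {a : L} :
    a ∈ f.charpoly.roots.toFinset ↔ 0 < Module.finrank L (f.maxGenEigenspace a) := by
  rw [LinearMap.finrank_maxGenEigenspace_eq, Multiset.mem_toFinset, ← Multiset.count_pos,
    Polynomial.count_roots]

theorem maxGenEigenspace_eq_eigenspace_of_finrank_le_one {a : L}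
    (h : Module.finrank L (f.maxGenEigenspace a) ≤ 1) :
    f.maxGenEigenspace a = f.eigenspace a := by
  refine le_antisymm (fun w hw => ?_) (f.genEigenspace a |>.mono le_top)
  rw [Module.End.mem_eigenspace_iff]
  by_contra hne
  obtain ⟨k, hk⟩ := (Module.End.mem_maxGenEigenspace f a w).1 hw
  have hw0 : w ≠ 0 := fun h0 => hne (by rw [h0, map_zero, smul_zero])
  obtain ⟨v, hv⟩ := finrank_le_one_iff.1 h
  obtain ⟨c, hc⟩ := hv ⟨w, hw⟩
  obtain ⟨d, hd⟩ := hv ⟨f w, f.mapsTo_maxGenEigenspace_of_comm (Commute.refl f) a hw⟩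
  have hc' : c • (v : n → L) = w := congr_arg Subtype.val hc
  have hd' : d • (v : n → L) = f w := congr_arg Subtype.val hd
  have hc0 : c ≠ 0 := by
    rintro rfl
    exact hw0 (by rw [← hc', zero_smul])
  have hfw : f w = (d / c) • w := by
    rw [← hd', ← hc', smul_smul, div_mul_cancel₀ _ hc0]
  have hpow : ∀ m : ℕ, ((f - a • 1) ^ m) w = (d / c - a) ^ m • w := by
    intro m
    induction m with
    | zero => simp
    | succ m ih =>
      rw [pow_succ', Module.End.mul_apply, ih, map_smul, LinearMap.sub_apply, hfw,
        LinearMap.smul_apply, Module.End.one_apply, ← sub_smul, smul_smul, pow_succ]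
  rw [hpow] at hk
  rcases smul_eq_zero.1 hk with h1 | h1
  · have h2 : d / c - a = 0 := (pow_eq_zero_iff (by rintro rfl; simp at h1)).1 h1
    exact hne (by rw [hfw, sub_eq_zero.1 h2])
  · exact hw0 h1

variable [IsAlgClosed L] [CharZero L]

theorem two_le_finrank_maxGenEigenspace (hf : ∀ u v, f u ⬝ᵥ v = u ⬝ᵥ f v)
    (hy : ∀ u v, y u ⬝ᵥ v = -(u ⬝ᵥ y v)) (hyf : Commute f y) {a : L} {w : n → L}
    (hw : w ∈ f.maxGenEigenspace a) (hyw : y w ≠ 0) :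
    2 ≤ Module.finrank L (f.maxGenEigenspace a) := by
  by_contra! hlt
  have hw0 : w ≠ 0 := fun h0 => hyw (by rw [h0, map_zero])
  refine hyw (eq_zero_on_of_le_span_pair hf hy hyf hw (fun v hv => ?_) hw)
  have h1 : Module.finrank L (f.maxGenEigenspace a) = 1 :=
    le_antisymm (by omega) (Module.finrank_pos_iff.2 ⟨⟨w, hw⟩, 0, by simpa using hw0⟩)
  obtain ⟨c, hc⟩ := (finrank_eq_one_iff_of_nonzero' (⟨w, hw⟩ : f.maxGenEigenspace a)
    (by simpa using hw0)).1 h1 ⟨v, hv⟩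
  have hc' : c • w = v := congr_arg Subtype.val hc
  rw [← hc']
  exact Submodule.smul_mem _ c (Submodule.subset_span (by simp))

theorem maxGenEigenspace_eq_eigenspace_of_finrank_eq_two (hf : ∀ u v, f u ⬝ᵥ v = u ⬝ᵥ f v)
    (hy : ∀ u v, y u ⬝ᵥ v = -(u ⬝ᵥ y v)) (hyf : Commute f y) {a : L} {w : n → L}
    (hw : w ∈ f.maxGenEigenspace a) (hyw : y w ≠ 0)
    (h2 : Module.finrank L (f.maxGenEigenspace a) = 2) :
    f.maxGenEigenspace a = f.eigenspace a := by
  refine le_antisymm (fun v hv => ?_) (f.genEigenspace a |>.mono le_top)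
  by_contra hne
  rw [Module.End.mem_eigenspace_iff] at hne
  have hv0 : v ≠ 0 := fun h0 => hne (by rw [h0, map_zero, smul_zero])
  refine hyw (eq_zero_on_of_le_span_pair hf hy hyf hv (le_of_eq ?_) hw)
  have hfv := f.mapsTo_maxGenEigenspace_of_comm (Commute.refl f) a hv
  refine (Submodule.eq_of_le_of_finrank_le (Submodule.span_le.2 ?_) ?_).symm
  · rintro x (rfl | rfl)
    · exact hv
    · exact hfv
  · have hli : LinearIndependent L ![v, f v] := by
      rw [LinearIndependent.pair_iff' hv0]
      intro c hc
      refine hne ?_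
      have hmem : v ∈ f.maxGenEigenspace c := f.genEigenspace c |>.mono le_top
        (Module.End.mem_eigenspace_iff.2 hc.symm)
      by_cases hac : a = c
      · rw [hac, hc]
      · exact absurd (Submodule.disjoint_def.1 (f.disjoint_genEigenspace hac ⊤ ⊤) v hv hmem) hv0
    have := finrank_span_eq_card hli
    rw [Matrix.range_cons, Matrix.range_cons, Matrix.range_empty, Set.union_empty,
      Set.singleton_union, Fintype.card_fin] at this
    rw [h2, this]

theorem card_roots_charpoly_of_skew_commute [DecidableEq L] (hf : ∀ u v, f u ⬝ᵥ v = u ⬝ᵥ f v)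
    (hy : ∀ u v, y u ⬝ᵥ v = -(u ⬝ᵥ y v)) (hyf : Commute f y) (hy0 : y ≠ 0) :
    f.charpoly.roots.toFinset.card + 2 ≤ Fintype.card n ∨
      f.charpoly.roots.toFinset.card + 1 ≤ Fintype.card n ∧ ⨆ a, f.eigenspace a = ⊤ := by
  obtain ⟨a, w, hw, hyw⟩ := exists_maxGenEigenspace_ne_zero (f := f) hy0
  have ha := two_le_finrank_maxGenEigenspace hf hy hyf hw hyw
  set S := f.charpoly.roots.toFinset
  set m : L → ℕ := fun c => Module.finrank L (f.maxGenEigenspace c)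
  have hsum : ∑ c ∈ S, m c = Fintype.card n := sum_finrank_maxGenEigenspace f
  have hpos : ∀ c ∈ S, 1 ≤ m c := fun c hc => mem_roots_charpoly_iff.1 hc
  have haS : a ∈ S := mem_roots_charpoly_iff.2 (by omega)
  have hsum' : ∑ c ∈ S, (m c - 1) + S.card = Fintype.card n := by
    rw [← hsum, Finset.card_eq_sum_ones, ← Finset.sum_add_distrib]
    exact Finset.sum_congr rfl fun c hc => Nat.sub_add_cancel (hpos c hc)
  have hle : m a - 1 ≤ ∑ c ∈ S, (m c - 1) :=
    Finset.single_le_sum (f := fun c => m c - 1) (fun _ _ => Nat.zero_le _) haS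
  by_cases h3 : 3 ≤ m a
  · left; omega
  have ham : m a = 2 := by
    have : 2 ≤ m a := ha
    omega
  by_cases hother : ∃ c ∈ S, c ≠ a ∧ 2 ≤ m c
  · obtain ⟨c, hc, hca, hmc⟩ := hother
    left
    have := Finset.add_le_sum (f := fun c => m c - 1) (fun _ _ => Nat.zero_le _) haS hc (Ne.symm hca)
    omega
  · right
    refine ⟨by omega, ?_⟩
    rw [← Module.End.iSup_maxGenEigenspace_eq_top f]
    congr 1
    funext c
    symm
    by_cases hca : c = a
    · rw [hca]
      exact maxGenEigenspace_eq_eigenspace_of_finrank_eq_two hf hy hyf hw hyw ham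
    · refine maxGenEigenspace_eq_eigenspace_of_finrank_le_one ?_
      by_contra! hc
      exact hother ⟨c, mem_roots_charpoly_iff.2 (by omega), hca, hc⟩

end CountEigenvalues

section MatrixDerivation

variable {n k R : Type*} [CommRing k] [CommRing R] [Algebra k R] (D : Derivation k R R)

theorem map_derivation_mul [Fintype n] {l m : Type*} (A : Matrix l n R) (B : Matrix n m R) :
    (A * B).map D = A.map D * B + A * B.map D := by
  ext i j
  simp only [map_apply, mul_apply, Matrix.add_apply, map_sum, Derivation.leibniz, smul_eq_mul,
    Finset.sum_add_distrib]
  rw [add_comm]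
  congr 1
  exact Finset.sum_congr rfl fun _ _ => mul_comm _ _

theorem map_derivation_sub {m : Type*} (A B : Matrix n m R) :
    (A - B).map D = A.map D - B.map D := by
  ext i j
  simp

theorem map_derivation_one [DecidableEq n] : (1 : Matrix n n R).map D = 0 := by
  ext i j
  by_cases h : i = j <;> simp [h]

theorem trace_mul_map_derivation_conj [Fintype n] [DecidableEq n] {B C P Q : Matrix n n R}
    (hPQ : P * Q = 1) (hBC : B * C = C * B) :
    trace (C * B.map D) = trace (Q * C * P * (Q * B * P).map D) := by
  have hQP : Q * P = 1 := mul_eq_one_comm.1 hPQ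
  have hD : Q.map D * P = -(Q * P.map D) := by
    rw [eq_neg_iff_add_eq_zero, ← map_derivation_mul, hQP, map_derivation_one]
  have hexp : (Q * B * P).map D = Q.map D * B * P + Q * B.map D * P + Q * B * P.map D := by
    rw [map_derivation_mul, map_derivation_mul, add_mul]
  have h1 : trace (Q * C * P * (Q.map D * B * P)) = trace (C * B * (P * Q.map D)) := by
    rw [← trace_mul_comm (P * Q.map D), ← trace_mul_comm]
    calc trace (Q.map D * B * P * (Q * C * P)) = trace (Q.map D * (B * (P * Q) * C * P)) := by
          simp only [mul_assoc]
      _ = trace (Q.map D * (C * B * P)) := by rw [hPQ, mul_one, hBC]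
      _ = trace (C * B * P * Q.map D) := trace_mul_comm _ _
      _ = trace (P * Q.map D * (C * B)) := by rw [mul_assoc (C * B), trace_mul_comm]
  have h2 : trace (Q * C * P * (Q * B.map D * P)) = trace (C * B.map D) := by
    rw [trace_mul_comm]
    calc trace (Q * B.map D * P * (Q * C * P)) = trace (Q * (B.map D * (P * Q) * C * P)) := by
          simp only [mul_assoc]
      _ = trace (B.map D * C * P * Q) := by rw [hPQ, mul_one, trace_mul_comm]
      _ = trace (C * B.map D) := by rw [mul_assoc, hPQ, mul_one, trace_mul_comm]
  have h3 : trace (Q * C * P * (Q * B * P.map D)) = trace (C * B * (P.map D * Q)) := by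
    calc trace (Q * C * P * (Q * B * P.map D)) = trace (Q * (C * (P * Q) * B * P.map D)) := by
          simp only [mul_assoc]
      _ = trace (C * B * P.map D * Q) := by rw [hPQ, mul_one, trace_mul_comm]
      _ = _ := by rw [mul_assoc]
  have h4 : P * Q.map D = -(P.map D * Q) := by
    rw [eq_neg_iff_add_eq_zero, add_comm, ← map_derivation_mul, hPQ, map_derivation_one]
  rw [hexp, mul_add, mul_add, trace_add, trace_add, h1, h2, h3, h4, mul_neg, trace_neg]
  ring

end MatrixDerivation

section CommonEigenvector

variable {L : Type*} [Field L]

theorem exists_mul_eq_one_mulVec_single {n : Type*} [Fintype n] [DecidableEq n] (i : n)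
    {v : n → L} (hv : v ≠ 0) :
    ∃ P Q : Matrix n n L, P * Q = 1 ∧ P *ᵥ Pi.single i 1 = v := by
  have hi : (Pi.single i 1 : n → L) ≠ 0 := by
    intro h
    have := congr_fun h i
    simp at this
  obtain ⟨g, hg⟩ := Submodule.exists_linearEquiv_restrict_eq
    ((LinearEquiv.toSpanNonzeroSingleton L _ _ hi).symm.trans
      (LinearEquiv.toSpanNonzeroSingleton L _ _ hv))
  refine ⟨LinearMap.toMatrix' g.toLinearMap, LinearMap.toMatrix' g.symm.toLinearMap, ?_, ?_⟩
  · rw [← LinearMap.toMatrix'_comp]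
    simp
  · rw [LinearMap.toMatrix'_mulVec]
    have h := hg ⟨Pi.single i 1, Submodule.mem_span_singleton_self _⟩
    have h1 : (LinearEquiv.toSpanNonzeroSingleton L _ _ hi).symm
        ⟨Pi.single i 1, Submodule.mem_span_singleton_self _⟩ = 1 := by
      rw [LinearEquiv.symm_apply_eq, LinearEquiv.toSpanNonzeroSingleton_one]
    rw [LinearEquiv.trans_apply, h1, LinearEquiv.toSpanNonzeroSingleton_one] at h
    exact h.symm

theorem exists_common_eigenvector [IsAlgClosed L] {V : Type*} [AddCommGroup V] [Module L V]
    [FiniteDimensional L V] [Nontrivial V] {f g : Module.End L V} (h : Commute f g) :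
    ∃ (a c : L) (v : V), v ≠ 0 ∧ f v = a • v ∧ g v = c • v := by
  obtain ⟨a, ha⟩ := Module.End.exists_eigenvalue f
  have hmaps : ∀ x ∈ f.eigenspace a, g x ∈ f.eigenspace a :=
    fun x hx => Module.End.mapsTo_genEigenspace_of_comm h a 1 hx
  have : Nontrivial (f.eigenspace a) := Submodule.nontrivial_iff_ne_bot.2 ha
  obtain ⟨c, hc⟩ := Module.End.exists_eigenvalue (g.restrict hmaps)
  obtain ⟨v, hv⟩ := hc.exists_hasEigenvector
  refine ⟨a, c, v, by simpa using hv.2, Module.End.mem_eigenspace_iff.1 v.2, ?_⟩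
  exact congr_arg Subtype.val (Module.End.mem_eigenspace_iff.1 hv.1)

theorem charpoly_of_first_column {m : ℕ} {B : Matrix (Fin (m + 1)) (Fin (m + 1)) L}
    (hB : ∀ i : Fin m, B i.succ 0 = 0) :
    B.charpoly = (Polynomial.X - Polynomial.C (B 0 0)) *
      (B.submatrix Fin.succ Fin.succ).charpoly := by
  rw [charpoly, det_succ_column_zero, Fin.sum_univ_succ]
  rw [Finset.sum_eq_zero, add_zero]
  · simp only [Fin.val_zero, pow_zero, one_mul, charmatrix_apply_eq, Fin.succAbove_zero]
    congr 1
    rw [charpoly]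
    congr 1
    ext i j : 1
    by_cases hij : i = j
    · subst hij; simp
    · rw [submatrix_apply, charmatrix_apply_ne _ _ _ (fun h => hij (Fin.succ_injective _ h)),
        charmatrix_apply_ne _ _ _ hij, submatrix_apply]
  · intro i _
    rw [charmatrix_apply_ne _ _ _ (Fin.succ_ne_zero i), hB]
    simp

/-- If `D` kills the eigenvalues of `B`, then `DB` is orthogonal to the centralizer of `B`
with respect to the trace form. -/
theorem trace_mul_map_derivation_eq_zero [IsAlgClosed L] {k : Type*} [CommRing k] [Algebra k L]
    (D : Derivation k L L) {m : ℕ} {B C : Matrix (Fin m) (Fin m) L} (hBC : B * C = C * B)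
    (hD : ∀ a ∈ B.charpoly.roots, D a = 0) : trace (C * B.map D) = 0 := by
  induction m with
  | zero => simp [trace]
  | succ m ih =>
    obtain ⟨a, c, v, hv, hBv, hCv⟩ := exists_common_eigenvector
      (f := toLin' B) (g := toLin' C) (by
        rw [commute_iff_eq, Module.End.mul_eq_comp, Module.End.mul_eq_comp, ← toLin'_mul,
          ← toLin'_mul, hBC])
    obtain ⟨P, Q, hPQ, hPv⟩ := exists_mul_eq_one_mulVec_single (0 : Fin (m + 1)) hv
    have hQP : Q * P = 1 := mul_eq_one_comm.1 hPQ
    have hcol : ∀ (A : Matrix (Fin (m + 1)) (Fin (m + 1)) L) (d : L), A *ᵥ v = d • v →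
        ∀ i, (Q * A * P) i 0 = d * (Pi.single 0 1 : Fin (m + 1) → L) i := by
      intro A d hA i
      have : (Q * A * P) *ᵥ Pi.single 0 1 = d • Pi.single 0 1 := by
        rw [← mulVec_mulVec, hPv, ← mulVec_mulVec, hA, mulVec_smul, ← hPv, mulVec_mulVec, hQP,
          one_mulVec]
      rw [mulVec_single_one] at this
      exact congr_fun this i
    have hB' := hcol B a hBv
    have hC' := hcol C c hCv
    have hcharpoly : (Q * B * P).charpoly = B.charpoly := by
      rw [mul_assoc, charpoly_mul_comm, mul_assoc, hPQ, mul_one]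
    have hcomm : (Q * B * P) * (Q * C * P) = (Q * C * P) * (Q * B * P) := by
      calc (Q * B * P) * (Q * C * P) = Q * (B * (P * Q) * C) * P := by simp only [mul_assoc]
        _ = Q * (C * (P * Q) * B) * P := by rw [hPQ, mul_one, mul_one, hBC]
        _ = _ := by simp only [mul_assoc]
    rw [trace_mul_map_derivation_conj D hPQ hBC]
    rw [← hcharpoly] at hD
    generalize Q * B * P = B' at *
    generalize Q * C * P = C' at *
    have hB0 : ∀ i : Fin m, B' i.succ 0 = 0 := fun i => by rw [hB']; simp
    have hC0 : ∀ i : Fin m, C' i.succ 0 = 0 := fun i => by rw [hC']; simp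
    rw [charpoly_of_first_column hB0, Polynomial.roots_mul
      (mul_ne_zero (Polynomial.X_sub_C_ne_zero _) (charpoly_monic _).ne_zero),
      Polynomial.roots_X_sub_C] at hD
    have hcomm' : B'.submatrix Fin.succ Fin.succ * C'.submatrix Fin.succ Fin.succ =
        C'.submatrix Fin.succ Fin.succ * B'.submatrix Fin.succ Fin.succ := by
      ext i j
      have := congr_fun (congr_fun hcomm i.succ) j.succ
      rw [mul_apply, mul_apply, Fin.sum_univ_succ, Fin.sum_univ_succ, hB0, hC0, zero_mul,
        zero_mul, zero_add, zero_add] at this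
      exact this
    have := ih hcomm' fun d hd => hD d (Multiset.mem_add.2 (Or.inr hd))
    have hD0 : D (B' 0 0) = 0 := hD _ (Multiset.mem_add.2 (Or.inl (by simp)))
    rw [← this]
    simp only [trace, diag_apply, mul_apply, map_apply, submatrix_apply]
    simp [Fin.sum_univ_succ, hB0, hC0, hD0]

end CommonEigenvector

section TangentSpace

theorem finrank_map_add_finrank_inf_ker {K V W : Type*} [Field K] [AddCommGroup V] [Module K V]
    [AddCommGroup W] [Module K W] [FiniteDimensional K V] (θ : V →ₗ[K] W) (F : Submodule K V) :
    Module.finrank K (F.map θ) + Module.finrank K (F ⊓ LinearMap.ker θ : Submodule K V) =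
      Module.finrank K F := by
  rw [← LinearMap.finrank_range_add_finrank_ker (θ.domRestrict F), LinearMap.range_domRestrict,
    LinearMap.ker_domRestrict, ← Submodule.map_comap_subtype, Submodule.finrank_map_subtype_eq]

theorem finrank_range_le_of_ker_le {K V W U : Type*} [Field K] [AddCommGroup V] [Module K V]
    [AddCommGroup W] [Module K W] [AddCommGroup U] [Module K U] [FiniteDimensional K W]
    {f : V →ₗ[K] W} {g : V →ₗ[K] U} (h : LinearMap.ker f ≤ LinearMap.ker g) :
    Module.finrank K (LinearMap.range g) ≤ Module.finrank K (LinearMap.range f) := by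
  have := LinearMap.finrank_range_le
    ((Submodule.liftQ (LinearMap.ker f) g h) ∘ₗ f.quotKerEquivRange.symm.toLinearMap)
  rwa [LinearMap.range_comp, LinearEquiv.range, Submodule.map_top, Submodule.range_liftQ] at this

variable {n k L : Type*} [Field L] [CommRing k] [Algebra k L] [Fintype n]

/-- The symmetric matrices commuting with `B`. -/
def symCentralizer (B : Matrix n n L) : Submodule L (Matrix n n L) :=
  symMatrix n L ⊓ LinearMap.ker (LinearMap.mulLeft L B - LinearMap.mulRight L B)

theorem mem_symCentralizer {A B : Matrix n n L} :
    A ∈ symCentralizer B ↔ A ∈ symMatrix n L ∧ B * A = A * B := by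
  rw [symCentralizer, Submodule.mem_inf, LinearMap.mem_ker, LinearMap.sub_apply, sub_eq_zero]
  rfl

omit [Fintype n] in
variable (k) in
/-- The entrywise application of derivations to a matrix. -/
def mapDerivation (B : Matrix n n L) : Derivation k L L →ₗ[L] Matrix n n L where
  toFun D := B.map D
  map_add' _ _ := rfl
  map_smul' _ _ := rfl

omit [Fintype n] in
@[simp] theorem mapDerivation_apply (B : Matrix n n L) (D : Derivation k L L) :
    mapDerivation k B D = B.map D := rfl

omit [Fintype n] in
theorem map_derivation_mem_symMatrix {B : Matrix n n L} (hB : B ∈ symMatrix n L)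
    (D : Derivation k L L) : B.map D ∈ symMatrix n L := by
  rw [mem_symMatrix] at *
  rw [← transpose_map, hB]

variable [CharZero L]

theorem finrank_inf_ker_add_finrank_le [DecidableEq n] (Z : Submodule L (Matrix n n L))
    (hZ : Z ≤ symMatrix n L) :
    ∃ θ : Matrix n n L →ₗ[L] Module.Dual L Z, (∀ A C, θ A C = trace ((C : Matrix n n L) * A)) ∧
      Module.finrank L (symMatrix n L ⊓ LinearMap.ker θ : Submodule L (Matrix n n L)) +
        Module.finrank L Z = Module.finrank L (symMatrix n L) := by
  let θ : Matrix n n L →ₗ[L] Module.Dual L Z :=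
    LinearMap.mk₂ L (fun A C => trace ((C : Matrix n n L) * A))
      (fun A A' C => by rw [mul_add, trace_add]) (fun c A C => by simp)
      (fun A C C' => by rw [Submodule.coe_add, add_mul, trace_add]) (fun c A C => by simp)
  refine ⟨θ, fun _ _ => rfl, ?_⟩
  rw [← finrank_map_add_finrank_inf_ker θ (symMatrix n L), add_comm]
  congr 1
  rw [← Subspace.finrank_add_finrank_dualCoannihilator_eq ((symMatrix n L).map θ)]
  suffices ((symMatrix n L).map θ).dualCoannihilator = ⊥ by rw [this, finrank_bot, add_zero]
  rw [eq_bot_iff]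
  intro C hC
  rw [Submodule.mem_dualCoannihilator] at hC
  rw [Submodule.mem_bot]
  exact Subtype.ext (eq_zero_of_forall_trace_mul_eq_zero (hZ C.2)
    fun A hA => hC _ (Submodule.mem_map_of_mem hA))

theorem finrank_range_mapDerivation_add_le [IsAlgClosed L] [DecidableEq L] {m : ℕ}
    {B : Matrix (Fin m) (Fin m) L} (hB : B ∈ symMatrix (Fin m) L) :
    Module.finrank L (LinearMap.range (mapDerivation k B)) +
      Module.finrank L (symCentralizer B) ≤
        B.charpoly.roots.toFinset.card + Module.finrank L (symMatrix (Fin m) L) := by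
  obtain ⟨θ, hθ, hdim⟩ := finrank_inf_ker_add_finrank_le (symCentralizer B) inf_le_left
  have h1 := finrank_map_add_finrank_inf_ker θ (LinearMap.range (mapDerivation k B))
  have h2 : Module.finrank L
      (LinearMap.range (mapDerivation k B) ⊓ LinearMap.ker θ : Submodule L _) ≤
      Module.finrank L (symMatrix (Fin m) L ⊓ LinearMap.ker θ : Submodule L _) := by
    refine Submodule.finrank_mono (inf_le_inf_right _ ?_)
    rintro _ ⟨D, rfl⟩
    exact map_derivation_mem_symMatrix hB D
  let ev : Derivation k L L →ₗ[L] (B.charpoly.roots.toFinset → L) :=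
    { toFun := fun D a => D a
      map_add' := fun _ _ => rfl
      map_smul' := fun _ _ => rfl }
  have h3 : Module.finrank L ((LinearMap.range (mapDerivation k B)).map θ) ≤
      B.charpoly.roots.toFinset.card := by
    rw [← LinearMap.range_comp]
    refine (finrank_range_le_of_ker_le (f := ev) fun D hD => ?_).trans
      ((Submodule.finrank_le _).trans (by simp))
    rw [LinearMap.mem_ker]
    ext C
    rw [LinearMap.comp_apply, hθ, mapDerivation_apply]
    refine trace_mul_map_derivation_eq_zero D (mem_symCentralizer.1 C.2).2 fun a ha => ?_
    exact congr_fun (LinearMap.mem_ker.1 hD) ⟨a, Multiset.mem_toFinset.2 ha⟩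
  omega

omit [CharZero L] in
theorem dotProduct_map_derivation_mulVec_eq_zero {B : Matrix n n L} (hB : B ∈ symMatrix n L)
    {a : L} {e : n → L} (he : B *ᵥ e = a • e) (hee : e ⬝ᵥ e = 0) (D : Derivation k L L) :
    e ⬝ᵥ (B.map D *ᵥ e) = 0 := by
  have hsym : e ⬝ᵥ (B *ᵥ (D ∘ e)) = a * (e ⬝ᵥ (D ∘ e)) := by
    rw [dotProduct_mulVec, ← mulVec_transpose, mem_symMatrix.1 hB, he, smul_dotProduct, smul_eq_mul]
  have h1 : B.map D *ᵥ e + B *ᵥ (D ∘ e) = D a • e + a • (D ∘ e) := by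
    have : D ∘ (B *ᵥ e) = D ∘ (a • e) := by rw [he]
    funext i
    have hi := congr_fun this i
    simp only [Function.comp_apply, mulVec, dotProduct, map_sum, Derivation.leibniz, Pi.smul_apply,
      smul_eq_mul, Finset.sum_add_distrib] at hi
    simp only [Pi.add_apply, mulVec, dotProduct, map_apply, Function.comp_apply, Pi.smul_apply,
      smul_eq_mul]
    rw [add_comm, mul_comm (D a), add_comm (e i * D a), ← hi]
    congr 1
    exact Finset.sum_congr rfl fun _ _ => mul_comm _ _
  have h2 := congr_arg (e ⬝ᵥ ·) h1
  simp only [dotProduct_add, dotProduct_smul, hee, hsym, smul_eq_mul, mul_zero, zero_add] at h2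
  exact add_eq_right.1 h2

omit [CharZero L] in
theorem toLin'_selfAdjoint [DecidableEq n] {B : Matrix n n L} (hB : B ∈ symMatrix n L)
    (u v : n → L) : toLin' B u ⬝ᵥ v = u ⬝ᵥ toLin' B v := by
  rw [toLin'_apply, toLin'_apply, dotProduct_mulVec, ← mulVec_transpose, mem_symMatrix.1 hB]

omit [CharZero L] in
theorem toLin'_skewAdjoint [DecidableEq n] {Y : Matrix n n L} (hY : Y ∈ skewMatrix n L)
    (u v : n → L) : toLin' Y u ⬝ᵥ v = -(u ⬝ᵥ toLin' Y v) := by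
  rw [toLin'_apply, toLin'_apply, dotProduct_mulVec, ← mulVec_transpose, mem_skewMatrix.1 hY,
    neg_mulVec, neg_dotProduct, neg_neg]

omit [CharZero L] in
theorem symCentralizer_not_le [DecidableEq n] {B : Matrix n n L} (hB : B ∈ symMatrix n L)
    (hspan : ⨆ a, Module.End.eigenspace (toLin' B) a = ⊤) {e : n → L} (he : e ≠ 0)
    {K : Submodule L (Matrix n n L)} (hK : ∀ A ∈ K, e ⬝ᵥ (A *ᵥ e) = 0) :
    ¬ symCentralizer B ≤ K := by
  intro hle
  refine he (dotProduct_eq_zero e fun v => ?_)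
  have hv : v ∈ ⨆ a, Module.End.eigenspace (toLin' B) a := by rw [hspan]; trivial
  induction hv using Submodule.iSup_induction' with
  | mem c u hu =>
    rw [Module.End.mem_eigenspace_iff, toLin'_apply] at hu
    have hmem : vecMulVec u u ∈ symCentralizer B := by
      refine mem_symCentralizer.2 ⟨transpose_vecMulVec u u, ?_⟩
      rw [mul_vecMulVec, vecMulVec_mul, ← mulVec_transpose, mem_symMatrix.1 hB, hu,
        smul_vecMulVec, vecMulVec_smul]
    have := hK _ (hle hmem)
    rw [vecMulVec_mulVec, dotProduct_smul, dotProduct_comm u e] at this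
    simpa using this
  | zero => exact dotProduct_zero e
  | add v w _ _ hv hw => rw [dotProduct_add, hv, hw, add_zero]

/-- The dimension bound for the space of tangent vectors `(DB₁, DB₂)` to a point `(B₁, B₂)` at
which neither coordinate is regular. -/
theorem finrank_range_prod_mapDerivation_add_two_le [IsAlgClosed L] {m : ℕ}
    {B₁ B₂ : Matrix (Fin m) (Fin m) L}
    (h₁ : B₁ ∈ symMatrix (Fin m) L) (h₂ : B₂ ∈ symMatrix (Fin m) L)
    (hs₁ : ¬ AdSurjective B₁) (hs₂ : ¬ AdSurjective B₂)
    (hD : ∀ D : Derivation k L L, (B₁ * B₂ - B₂ * B₁).map D = 0) :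
    Module.finrank L (LinearMap.range ((mapDerivation k B₁).prod (mapDerivation k B₂))) + 2 ≤
      Module.finrank L (symMatrix (Fin m) L) + m := by
  classical
  set T := LinearMap.range ((mapDerivation k B₁).prod (mapDerivation k B₂)) with hT
  set F := LinearMap.fst L (Matrix (Fin m) (Fin m) L) (Matrix (Fin m) (Fin m) L)
  set K := (T ⊓ LinearMap.ker F).map (LinearMap.snd L _ _)
  have hfst : T.map F = LinearMap.range (mapDerivation k B₁) := by
    rw [hT, ← LinearMap.range_comp, LinearMap.fst_prod]
  have hdim := finrank_map_add_finrank_inf_ker F T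
  rw [hfst] at hdim
  have hKdim : Module.finrank L (T ⊓ LinearMap.ker F : Submodule L _) = Module.finrank L K := by
    rw [← finrank_map_add_finrank_inf_ker (LinearMap.snd L _ _) (T ⊓ LinearMap.ker F)]
    refine Nat.add_eq_left.2 ?_
    rw [Submodule.finrank_eq_zero, eq_bot_iff]
    rintro ⟨A, B⟩ ⟨⟨-, hA⟩, hB⟩
    exact Prod.ext hA hB
  have hKmem : ∀ A ∈ K, ∃ D : Derivation k L L, B₁.map D = 0 ∧ B₂.map D = A := by
    rintro _ ⟨_, ⟨⟨D, rfl⟩, h0⟩, rfl⟩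
    exact ⟨D, h0, rfl⟩
  have hKle : K ≤ symCentralizer B₁ := by
    intro A hA
    obtain ⟨D, hD₁, rfl⟩ := hKmem A hA
    refine mem_symCentralizer.2 ⟨map_derivation_mem_symMatrix h₂ D, ?_⟩
    have := hD D
    rwa [map_derivation_sub, map_derivation_mul, map_derivation_mul, hD₁, zero_mul, mul_zero,
      zero_add, add_zero, sub_eq_zero] at this
  have hbound := finrank_range_mapDerivation_add_le (k := k) h₁
  obtain ⟨Y₁, hY₁, hY₁0, hc₁⟩ := exists_skewMatrix_commute h₁ hs₁
  obtain ⟨Y₂, hY₂, hY₂0, hc₂⟩ := exists_skewMatrix_commute h₂ hs₂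
  have hcomm : ∀ {Y B : Matrix (Fin m) (Fin m) L}, Commute Y B →
      Commute (toLin' B) (toLin' Y) := by
    intro Y B h
    rw [commute_iff_eq, Module.End.mul_eq_comp, Module.End.mul_eq_comp, ← toLin'_mul,
      ← toLin'_mul, h.eq]
  have hroots := card_roots_charpoly_of_skew_commute (toLin'_selfAdjoint h₁)
    (toLin'_skewAdjoint hY₁) (hcomm hc₁) (by simpa using hY₁0)
  rw [charpoly_toLin', Fintype.card_fin] at hroots
  rcases hroots with hr | ⟨hr, hspan⟩
  · have := Submodule.finrank_mono hKle
    omega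
  · obtain ⟨a, e, he0, he, hee⟩ := exists_isotropic_eigenvector (toLin'_selfAdjoint h₂)
      (toLin'_skewAdjoint hY₂) (hcomm hc₂) (by simpa using hY₂0)
    have hlt : K < symCentralizer B₁ := lt_of_le_not_ge hKle
      (symCentralizer_not_le h₁ hspan he0 fun A hA => by
        obtain ⟨D, -, rfl⟩ := hKmem A hA
        exact dotProduct_map_derivation_mulVec_eq_zero h₂ he hee D)
    have := Submodule.finrank_lt_finrank_of_lt hlt
    omega

end TangentSpace

section Height

open Polynomial in
/-- The height of a prime ideal of `R[X]`, compared with that of its contraction `ker ψ` to `R`. -/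
theorem height_ker_comp_C_le {R F : Type*} [CommRing R] [IsNoetherianRing R] [Field F]
    (φ : R[X] →+* F) :
    (RingHom.ker (φ.comp C)).height ≤ (RingHom.ker φ).height ∧
      (¬ RingHom.ker φ ≤ (RingHom.ker (φ.comp C)).map C →
        (RingHom.ker (φ.comp C)).height + 1 ≤ (RingHom.ker φ).height) := by
  set p := RingHom.ker (φ.comp C)
  set P := RingHom.ker φ
  have hp : p.IsPrime := RingHom.ker_isPrime _
  have hP : P.IsPrime := RingHom.ker_isPrime _
  have : P.LiesOver p := ⟨rfl⟩
  have hht := Ideal.height_eq_height_add_of_liesOver_of_hasGoingDown p P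
  refine ⟨hht ▸ le_self_add, fun hle => ?_⟩
  rw [hht]
  refine add_le_add_right ?_ _
  rw [Polynomial.algebraMap_eq]
  have hpC : (p.map (C : R →+* R[X])).IsPrime := Ideal.isPrime_map_C_of_isPrime
  have hPle : p.map C ≤ P := Ideal.map_le_iff_le_comap.2 le_rfl
  have hprime : (P.map (Ideal.Quotient.mk (p.map (C : R →+* R[X])))).IsPrime :=
    Ideal.isPrime_map_quotientMk_of_isPrime hPle
  rw [Order.one_le_iff_ne_zero, Ne, Ideal.height_eq_zero_iff_eq_bot, Ideal.map_eq_bot_iff_le_ker,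
    Ideal.mk_ker]
  exact hle

theorem exists_algebraicIndependent_height {K F : Type*} [Field K] [Field F] [Algebra K F] {N : ℕ}
    (φ : MvPolynomial (Fin N) K →ₐ[K] F) :
    ∃ (ι : Type) (_ : Fintype ι) (g : ι → Fin N),
      AlgebraicIndependent K (fun i => φ (MvPolynomial.X (g i))) ∧
        (N : ℕ∞) ≤ (RingHom.ker φ).height + Fintype.card ι := by
  induction N with
  | zero =>
    refine ⟨Empty, inferInstance, Empty.elim, ?_, by simp⟩
    exact (algebraicIndependent_empty_type_iff).2 (algebraMap K F).injective
  | succ N ih =>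
    let e := MvPolynomial.finSuccEquiv K N
    let φ' : Polynomial (MvPolynomial (Fin N) K) →ₐ[K] F := φ.comp e.symm.toAlgHom
    let ψ : MvPolynomial (Fin N) K →ₐ[K] F := φ.comp (MvPolynomial.rename Fin.succ)
    have hC : ∀ r, φ' (Polynomial.C r) = ψ r := by
      intro r
      change φ (e.symm (Polynomial.C r)) = φ _
      congr 1
      rw [AlgEquiv.symm_apply_eq]
      change Polynomial.C r = e (MvPolynomial.rename Fin.succ r)
      induction r using MvPolynomial.induction_on with
      | C a => simp [e, MvPolynomial.finSuccEquiv_apply]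
      | add p q hp hq => rw [map_add, map_add, map_add, hp, hq]
      | mul_X p i hp => rw [map_mul, map_mul, map_mul, hp, MvPolynomial.rename_X,
          MvPolynomial.finSuccEquiv_X_succ]
    have hX : φ' Polynomial.X = φ (MvPolynomial.X 0) := by
      change φ (e.symm Polynomial.X) = φ _
      congr 1
      rw [AlgEquiv.symm_apply_eq, MvPolynomial.finSuccEquiv_X_zero]
    have hker : RingHom.ker φ = (RingHom.ker φ').comap e.toRingEquiv := by
      ext x
      change φ x = 0 ↔ φ (e.symm (e x)) = 0
      rw [e.symm_apply_apply]
    have hψ : RingHom.ker ψ = RingHom.ker ((φ' : _ →+* F).comp Polynomial.C) := by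
      ext x
      change ψ x = 0 ↔ φ' (Polynomial.C x) = 0
      rw [hC]
    obtain ⟨ι, _, g, hg, hN⟩ := ih ψ
    obtain ⟨h1, h2⟩ := height_ker_comp_C_le (φ' : Polynomial (MvPolynomial (Fin N) K) →+* F)
    rw [hker, RingEquiv.height_comap]
    rw [← hψ] at h1 h2
    by_cases hle : RingHom.ker φ' ≤ (RingHom.ker ψ).map Polynomial.C
    · refine ⟨Option ι, inferInstance, fun o => o.elim 0 (fun i => (g i).succ), ?_, ?_⟩
      · have hfun : (fun o : Option ι => φ (MvPolynomial.X (o.elim 0 fun i => (g i).succ))) =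
            fun o : Option ι => o.elim (φ (MvPolynomial.X 0))
              (fun i => ψ (MvPolynomial.X (g i))) := by
          funext o
          cases o with
          | none => rfl
          | some i => simp [ψ]
        rw [hfun, hg.option_iff_transcendental, transcendental_iff]
        intro q hq
        have hrange : Algebra.adjoin K (Set.range fun i => ψ (MvPolynomial.X (g i))) ≤ ψ.range :=
          Algebra.adjoin_le (by rintro _ ⟨i, rfl⟩; exact ⟨_, rfl⟩)
        have hlift : q.map (algebraMap _ F) ∈
            Polynomial.lifts (ψ : MvPolynomial (Fin N) K →+* F) := by
          rw [Polynomial.lifts_iff_coeff_lifts]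
          intro m
          rw [Polynomial.coeff_map]
          exact hrange (q.coeff m).2
        obtain ⟨Q, hQ⟩ := (Polynomial.mem_lifts _).1 hlift
        have heval : (φ' : _ →+* F) = Polynomial.eval₂RingHom (ψ : MvPolynomial (Fin N) K →+* F)
            (φ (MvPolynomial.X 0)) := by
          refine Polynomial.ringHom_ext (fun a => ?_) ?_
          · simpa using hC a
          · simpa using hX
        have hφQ : φ' Q = 0 := by
          have : φ' Q = _ := RingHom.congr_fun heval Q
          rw [this, Polynomial.coe_eval₂RingHom, ← Polynomial.eval_map, hQ, Polynomial.eval_map,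
            ← Polynomial.aeval_def, hq]
        have hQmem := Ideal.mem_map_C_iff.1 (hle hφQ)
        refine Polynomial.map_injective _ (FaithfulSMul.algebraMap_injective _ F) ?_
        rw [← hQ, Polynomial.map_zero]
        ext m
        rw [Polynomial.coeff_map, Polynomial.coeff_zero]
        exact hQmem m
      · rw [Fintype.card_option]
        push_cast
        rw [← add_assoc]
        exact add_le_add_left (hN.trans (add_le_add_left h1 _)) _
    · refine ⟨ι, inferInstance, fun i => (g i).succ, ?_, ?_⟩
      · simpa [ψ] using hg
      · push_cast
        refine (add_le_add_left hN _).trans ?_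
        rw [add_right_comm]
        exact add_le_add_left (h2 hle) _

end Height

section Derivations

theorem exists_ringHom_lift {R L B : Type*} [CommRing R] [CommRing L] [CommRing B] [Algebra R L]
    [Algebra.FormallySmooth R L] (g : B →+* L) (hg : Function.Surjective g)
    (hker : IsNilpotent (RingHom.ker g)) (f₀ : R →+* B) (hf₀ : g.comp f₀ = algebraMap R L) :
    ∃ f : L →+* B, g.comp f = RingHom.id L ∧ f.comp (algebraMap R L) = f₀ := by
  let _ : Algebra R B := f₀.toAlgebra
  let g' : B →ₐ[R] L := { g with commutes' := fun r => RingHom.congr_fun hf₀ r }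
  let f := Algebra.FormallySmooth.liftOfSurjective (AlgHom.id R L) g' hg hker
  refine ⟨f, RingHom.ext fun x => ?_, RingHom.ext fun r => f.commutes r⟩
  exact Algebra.FormallySmooth.liftOfSurjective_apply (AlgHom.id R L) g' hg hker x

theorem formallySmooth_of_charZero (E L : Type*) [Field E] [Field L] [Algebra E L] [CharZero E] :
    Algebra.FormallySmooth E L := by
  obtain ⟨s, hs⟩ := exists_isTranscendenceBasis E L
  have hL : Algebra.IsAlgebraic (IntermediateField.adjoin E (Set.range ((↑) : s → L))) L :=
    hs.isAlgebraic_field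
  exact Algebra.FormallySmooth.of_algebraicIndependent_of_isSeparable hs.1

open scoped IntermediateField.algebraAdjoinAdjoin in
theorem formallySmooth_adjoin_of_algebraicIndependent {K L ι : Type*} [Field K] [Field L]
    [Algebra K L] [CharZero K] (v : ι → L) :
    Algebra.FormallySmooth (Algebra.adjoin K (Set.range v)) L := by
  have h1 : Algebra.FormallySmooth (Algebra.adjoin K (Set.range v))
      (IntermediateField.adjoin K (Set.range v)) := .of_isLocalization (nonZeroDivisors _)
  have h2 := formallySmooth_of_charZero (IntermediateField.adjoin K (Set.range v)) L
  exact .comp _ (IntermediateField.adjoin K (Set.range v)) _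

/-- In characteristic zero, derivations can be prescribed on an algebraically independent
family. -/
theorem exists_derivation_apply_eq {K L ι : Type*} [Field K] [Field L] [Algebra K L] [CharZero K]
    {v : ι → L} (hv : AlgebraicIndependent K v) (c : ι → L) :
    ∃ D : Derivation K L L, ∀ i, D (v i) = c i := by
  have := formallySmooth_adjoin_of_algebraicIndependent (K := K) v
  let h : MvPolynomial ι K →ₐ[K] TrivSqZeroExt L L :=
    MvPolynomial.aeval fun i => TrivSqZeroExt.inl (v i) + TrivSqZeroExt.inr (c i)
  let f₀ : Algebra.adjoin K (Set.range v) →ₐ[K] TrivSqZeroExt L L :=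
    h.comp hv.aevalEquiv.symm.toAlgHom
  let g : TrivSqZeroExt L L →ₐ[K] L := TrivSqZeroExt.fstHom K L L
  have hv₀ : ∀ i, f₀ ⟨v i, Algebra.subset_adjoin ⟨i, rfl⟩⟩ =
      TrivSqZeroExt.inl (v i) + TrivSqZeroExt.inr (c i) := by
    intro i
    have : hv.aevalEquiv.symm ⟨v i, Algebra.subset_adjoin ⟨i, rfl⟩⟩ = MvPolynomial.X i := by
      rw [AlgEquiv.symm_apply_eq]
      ext
      simp
    change h (hv.aevalEquiv.symm _) = _
    rw [this, MvPolynomial.aeval_X]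
  have hgf : g.toRingHom.comp f₀.toRingHom =
      algebraMap (Algebra.adjoin K (Set.range v)) L := by
    have h1 : (g.comp h) = MvPolynomial.aeval v := by
      ext i
      simp [g, h]
    ext x
    change (g.comp h) (hv.aevalEquiv.symm x) = x
    rw [h1, ← hv.algebraMap_aevalEquiv, AlgEquiv.apply_symm_apply]
    rfl
  obtain ⟨f, hf, hff₀⟩ := exists_ringHom_lift
    (R := Algebra.adjoin K (Set.range v)) g.toRingHom
    (fun x => ⟨TrivSqZeroExt.inl x, rfl⟩)
    ⟨2, by
      rw [Ideal.zero_eq_bot, pow_two, eq_bot_iff, Ideal.mul_le]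
      intro x hx y hy
      have hx' : x.fst = 0 := hx
      have hy' : y.fst = 0 := hy
      rw [Ideal.mem_bot]
      ext <;> simp [hx', hy']⟩ f₀.toRingHom hgf
  have hfst : ∀ x, (f x).fst = x := fun x => RingHom.congr_fun hf x
  have hK : ∀ r : K, f (algebraMap K L r) = algebraMap K _ r := by
    intro r
    have := RingHom.congr_fun hff₀ (algebraMap K _ r)
    rw [← f₀.commutes r]
    exact this
  let D₀ : L →ₗ[K] L :=
    { toFun := fun x => (f x).snd
      map_add' := fun x y => by simp
      map_smul' := fun r x => by
        rw [Algebra.smul_def, map_mul, hK, TrivSqZeroExt.snd_mul]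
        simp [TrivSqZeroExt.algebraMap_eq_inl', hfst, Algebra.smul_def] }
  refine ⟨Derivation.mk' D₀ fun x y => ?_, fun i => ?_⟩
  · change (f (x * y)).snd = x • (f y).snd + y • (f x).snd
    simp [hfst, mul_comm]
  · have := RingHom.congr_fun hff₀ ⟨v i, Algebra.subset_adjoin ⟨i, rfl⟩⟩
    change (f (v i)).snd = c i
    rw [show f (v i) = f₀ ⟨v i, Algebra.subset_adjoin ⟨i, rfl⟩⟩ from this, hv₀]
    simp

end Derivations

section CoordRing

variable {E : Type u} [AddCommGroup E] [Module ℂ E]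

/-- A linear form, as an element of the coordinate ring. -/
def linForm : Module.Dual ℂ E →ₗ[ℂ] coordRing E where
  toFun ξ := ⟨ξ, Algebra.subset_adjoin ⟨ξ, rfl⟩⟩
  map_add' _ _ := rfl
  map_smul' _ _ := rfl

@[simp] theorem evalAt_linForm (v : E) (ξ : Module.Dual ℂ E) : evalAt v (linForm ξ) = ξ v := rfl

theorem coordRing_ext {x y : coordRing E} (h : ∀ v, evalAt v x = evalAt v y) : x = y :=
  Subtype.ext (funext h)

theorem adjoin_range_linForm : Algebra.adjoin ℂ (Set.range (linForm (E := E))) = ⊤ := by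
  rw [eq_top_iff]
  rintro ⟨x, hx⟩ -
  induction hx using Algebra.adjoin_induction with
  | mem x hx => obtain ⟨ξ, rfl⟩ := hx; exact Algebra.subset_adjoin ⟨ξ, rfl⟩
  | algebraMap r => exact Subalgebra.algebraMap_mem _ r
  | add x y _ _ hx hy => exact add_mem hx hy
  | mul x y _ _ hx hy => exact mul_mem hx hy

/-- The coordinate ring is generated by linear forms without common zero. -/
theorem adjoin_linForm_eq_top {α : Type*} [Finite α] (l : α → Module.Dual ℂ E)
    (hl : ∀ x, (∀ a, l a x = 0) → x = 0) :
    Algebra.adjoin ℂ (Set.range fun a => linForm (l a)) = ⊤ := by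
  rw [eq_top_iff, ← adjoin_range_linForm]
  refine Algebra.adjoin_le ?_
  rintro _ ⟨ξ, rfl⟩
  have hξ : ξ ∈ Submodule.span ℂ (Set.range l) := by
    refine mem_span_of_iInf_ker_le_ker fun x hx => ?_
    rw [hl x fun a => (Submodule.mem_iInf _).1 hx a]
    exact Submodule.zero_mem _
  have : linForm ξ ∈ Submodule.span ℂ (Set.range fun a => linForm (l a)) := by
    have h := Submodule.mem_map_of_mem (f := linForm) hξ
    rwa [Submodule.map_span, ← Set.range_comp] at h
  exact Algebra.span_le_adjoin ℂ _ this

variable [FiniteDimensional ℂ E]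

variable (E) in
/-- The coordinate ring is a polynomial ring. -/
noncomputable def mvPolynomialEquiv :
    MvPolynomial (Fin (Module.finrank ℂ E)) ℂ ≃ₐ[ℂ] coordRing E :=
  AlgEquiv.ofBijective (MvPolynomial.aeval fun i => linForm ((Module.finBasis ℂ E).coord i)) <| by
    refine ⟨(injective_iff_map_eq_zero _).2 fun p hp => MvPolynomial.funext fun x => ?_, ?_⟩
    · let v : E := (Module.finBasis ℂ E).equivFun.symm x
      have h1 : (evalAt v).comp (MvPolynomial.aeval fun i =>
          linForm ((Module.finBasis ℂ E).coord i) : _ →ₐ[ℂ] coordRing E).toRingHom =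
            MvPolynomial.eval x := by
        refine MvPolynomial.ringHom_ext (fun r => ?_) fun i => ?_
        · simp [evalAt]
        · change evalAt v (MvPolynomial.aeval _ (MvPolynomial.X i)) = _
          rw [MvPolynomial.aeval_X, MvPolynomial.eval_X, evalAt_linForm, Module.Basis.coord_apply,
            ← Module.Basis.equivFun_apply, LinearEquiv.apply_symm_apply]
      rw [← h1, map_zero]
      change evalAt v (MvPolynomial.aeval _ p) = 0
      rw [hp, map_zero]
    · rw [← AlgHom.range_eq_top, ← Algebra.adjoin_range_eq_range_aeval]
      exact adjoin_linForm_eq_top _ fun x hx => (Module.finBasis ℂ E).ext_elem fun i => by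
        simpa using hx i

theorem mvPolynomialEquiv_X (i : Fin (Module.finrank ℂ E)) :
    mvPolynomialEquiv E (MvPolynomial.X i) = linForm ((Module.finBasis ℂ E).coord i) :=
  MvPolynomial.aeval_X _ i

theorem exists_coordRing_lift {A : Type*} [CommRing A] [Algebra ℂ A]
    (l : Module.Dual ℂ E →ₗ[ℂ] A) :
    ∃ φ : coordRing E →ₐ[ℂ] A, ∀ ξ, φ (linForm ξ) = l ξ := by
  let e := Module.finBasis ℂ E
  let φ : coordRing E →ₐ[ℂ] A :=
    (MvPolynomial.aeval fun i => l (e.coord i)).comp (mvPolynomialEquiv E).symm.toAlgHom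
  have hφ : ∀ i, φ (linForm (e.coord i)) = l (e.coord i) := by
    intro i
    change MvPolynomial.aeval _ ((mvPolynomialEquiv E).symm (linForm (e.coord i))) = _
    rw [← mvPolynomialEquiv_X, AlgEquiv.symm_apply_apply, MvPolynomial.aeval_X]
  refine ⟨φ, fun ξ => ?_⟩
  have hcomp : φ.toLinearMap ∘ₗ linForm = l := by
    refine e.dualBasis.ext fun i => ?_
    simpa using hφ i
  exact LinearMap.congr_fun hcomp ξ

instance : IsNoetherianRing (coordRing E) :=
  isNoetherianRing_of_ringEquiv _ (mvPolynomialEquiv E).toRingEquiv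

instance : Algebra.FinitePresentation ℂ (coordRing E) :=
  Algebra.FinitePresentation.equiv (mvPolynomialEquiv E)

theorem exists_algebraicIndependent_linForm {F : Type*} [Field F] [Algebra ℂ F]
    (φ : coordRing E →ₐ[ℂ] F) :
    ∃ (ι : Type) (_ : Fintype ι) (l : ι → Module.Dual ℂ E),
      AlgebraicIndependent ℂ (fun i => φ (linForm (l i))) ∧
        (Module.finrank ℂ E : ℕ∞) ≤ (RingHom.ker φ).height + Fintype.card ι := by
  obtain ⟨ι, hι, g, hg, hN⟩ :=
    exists_algebraicIndependent_height (φ.comp (mvPolynomialEquiv E).toAlgHom)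
  refine ⟨ι, hι, fun i => (Module.finBasis ℂ E).coord (g i), ?_, ?_⟩
  · simp_rw [← mvPolynomialEquiv_X]
    exact hg
  · have : RingHom.ker (φ.comp (mvPolynomialEquiv E).toAlgHom) =
        (RingHom.ker φ).comap (mvPolynomialEquiv E).toRingEquiv := rfl
    rwa [this, RingEquiv.height_comap] at hN

end CoordRing

section OrthonormalBasis

theorem exists_orthonormal_basis {V : Type u} [AddCommGroup V] [Module ℂ V]
    [FiniteDimensional ℂ V] (b : LinearMap.BilinForm ℂ V) (hsymm : b.IsSymm)
    (hnd : b.Nondegenerate) :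
    ∃ e : Module.Basis (Fin (Module.finrank ℂ V)) ℂ V,
      ∀ i j, b (e i) (e j) = (1 : Matrix _ _ ℂ) i j := by
  obtain ⟨e⟩ := QuadraticForm.equivalent_weightedSumSquares_of_isAlgClosed b.toQuadraticMap (by
    have : QuadraticMap.associated (R := ℂ) b.toQuadraticMap = b :=
      QuadraticMap.associated_left_inverse ℂ hsymm.eq
    rw [this]
    exact hnd.1)
  let f := e.toLinearEquiv
  have hq : ∀ v, ∑ i, f v i * f v i = b v v := by
    intro v
    have := e.map_app v
    rw [QuadraticMap.weightedSumSquares_apply] at this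
    simpa [f] using this
  have hb : ∀ u v, b u v = f u ⬝ᵥ f v := by
    intro u v
    have h1 := hq (u + v)
    have h2 := hsymm.eq u v
    simp only [map_add, LinearMap.add_apply, Pi.add_apply, mul_add, add_mul,
      Finset.sum_add_distrib, hq] at h1
    simp only [Finset.sum_congr rfl fun i _ => mul_comm (f v i) (f u i)] at h1
    simp only [dotProduct]
    linear_combination -h1 / 2 + h2 / 2
  refine ⟨Module.Basis.ofEquivFun f, fun i j => ?_⟩
  rw [hb]
  simp [Matrix.one_apply, Pi.single_apply, eq_comm]

end OrthonormalBasis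

section PointIdeal

variable {E : Type u} [AddCommGroup E] [Module ℂ E]

theorem evalAt_algebraMap (v : E) (r : ℂ) : evalAt v (algebraMap ℂ (coordRing E) r) = r := rfl

theorem evalAt_surjective (v : E) : Function.Surjective (evalAt v) :=
  fun r => ⟨algebraMap ℂ _ r, evalAt_algebraMap v r⟩

instance (v : E) : (RingHom.ker (evalAt v)).IsMaximal :=
  RingHom.ker_isMaximal_of_surjective _ (evalAt_surjective v)

variable [FiniteDimensional ℂ E]

theorem ker_evalAt_eq_span (v : E) : RingHom.ker (evalAt v) =
    Ideal.span (Set.range fun i => linForm ((Module.finBasis ℂ E).coord i) -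
      algebraMap ℂ (coordRing E) ((Module.finBasis ℂ E).coord i v)) := by
  set J := Ideal.span (Set.range fun i => linForm ((Module.finBasis ℂ E).coord i) -
      algebraMap ℂ (coordRing E) ((Module.finBasis ℂ E).coord i v)) with hJ
  refine le_antisymm (fun x hx => ?_) ?_
  · have key : ∀ y ∈ Algebra.adjoin ℂ
        (Set.range fun i => linForm ((Module.finBasis ℂ E).coord i)),
        y - algebraMap ℂ _ (evalAt v y) ∈ J := by
      intro y hy
      induction hy using Algebra.adjoin_induction with
      | mem y hy =>
        obtain ⟨i, rfl⟩ := hy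
        exact Ideal.subset_span ⟨i, rfl⟩
      | algebraMap r => rw [evalAt_algebraMap, sub_self]; exact J.zero_mem
      | add y z _ _ hy hz =>
        rw [map_add, map_add, add_sub_add_comm]
        exact J.add_mem hy hz
      | mul y z _ _ hy hz =>
        have : y * z - algebraMap ℂ _ (evalAt v (y * z)) =
            (y - algebraMap ℂ _ (evalAt v y)) * z +
              algebraMap ℂ _ (evalAt v y) * (z - algebraMap ℂ _ (evalAt v z)) := by
          rw [map_mul, map_mul]; ring
        rw [this]
        exact J.add_mem (J.mul_mem_right _ hy) (J.mul_mem_left _ hz)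
    have hx' := key x (by
      rw [adjoin_linForm_eq_top _ fun x hx => (Module.finBasis ℂ E).ext_elem fun i => by
        simpa using hx i]
      trivial)
    rwa [RingHom.mem_ker.1 hx, map_zero, sub_zero] at hx'
  · rw [hJ, Ideal.span_le]
    rintro _ ⟨i, rfl⟩
    rw [SetLike.mem_coe, RingHom.mem_ker, map_sub, evalAt_algebraMap, evalAt_linForm, sub_self]

theorem spanFinrank_map_ker_evalAt_le {R : Type*} [CommRing R] (f : coordRing E →+* R) (v : E) :
    Submodule.spanFinrank ((RingHom.ker (evalAt v)).map f) ≤ Module.finrank ℂ E := by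
  rw [ker_evalAt_eq_span, Ideal.map_span, ← Set.range_comp]
  refine (Submodule.spanFinrank_span_le_ncard_of_finite (Set.finite_range _)).trans ?_
  rw [← Set.image_univ]
  refine (Set.ncard_image_le Set.finite_univ).trans ?_
  rw [Set.ncard_univ, Nat.card_fin]

end PointIdeal

section GenericMatrix

variable {E : Type u} [AddCommGroup E] [Module ℂ E] {m : ℕ}

/-- The matrix of polynomial functions given by a matrix-valued linear map. -/
def genericMatrix (l : E →ₗ[ℂ] Matrix (Fin m) (Fin m) ℂ) :
    Matrix (Fin m) (Fin m) (coordRing E) :=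
  of fun i j => linForm (entryLinearMap ℂ ℂ i j ∘ₗ l)

theorem genericMatrix_apply (l : E →ₗ[ℂ] Matrix (Fin m) (Fin m) ℂ) (i j : Fin m) :
    genericMatrix l i j = linForm (entryLinearMap ℂ ℂ i j ∘ₗ l) := rfl

theorem genericMatrix_mem_symMatrix {l : E →ₗ[ℂ] Matrix (Fin m) (Fin m) ℂ}
    (hl : ∀ v, l v ∈ symMatrix (Fin m) ℂ) : genericMatrix l ∈ symMatrix (Fin m) (coordRing E) := by
  refine Matrix.ext fun i j => coordRing_ext fun v => ?_
  exact congr_fun (congr_fun (hl v) i) j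

theorem genericMatrix_mem_skewMatrix {l : E →ₗ[ℂ] Matrix (Fin m) (Fin m) ℂ}
    (hl : ∀ v, l v ∈ skewMatrix (Fin m) ℂ) :
    genericMatrix l ∈ skewMatrix (Fin m) (coordRing E) := by
  refine Matrix.ext fun i j => coordRing_ext fun v => ?_
  exact congr_fun (congr_fun (hl v) i) j

theorem map_mem_symMatrix {n R S : Type*} [CommRing R] [CommRing S] {M : Matrix n n R}
    (hM : M ∈ symMatrix n R) (f : R →+* S) : M.map f ∈ symMatrix n S := by
  rw [mem_symMatrix] at *
  rw [← transpose_map, hM]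

theorem map_mem_skewMatrix {n R S : Type*} [CommRing R] [CommRing S] {M : Matrix n n R}
    (hM : M ∈ skewMatrix n R) (f : R →+* S) : M.map f ∈ skewMatrix n S := by
  rw [mem_skewMatrix] at *
  rw [← transpose_map, hM]
  ext i j
  simp

/-- The first component of a vector in the coordinates `Φ`. -/
def coordFst (Φ : E ≃ₗ[ℂ] symMatrix (Fin m) ℂ × symMatrix (Fin m) ℂ) :
    E →ₗ[ℂ] Matrix (Fin m) (Fin m) ℂ :=
  (symMatrix (Fin m) ℂ).subtype ∘ₗ LinearMap.fst ℂ _ _ ∘ₗ Φ.toLinearMap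

/-- The second component of a vector in the coordinates `Φ`. -/
def coordSnd (Φ : E ≃ₗ[ℂ] symMatrix (Fin m) ℂ × symMatrix (Fin m) ℂ) :
    E →ₗ[ℂ] Matrix (Fin m) (Fin m) ℂ :=
  (symMatrix (Fin m) ℂ).subtype ∘ₗ LinearMap.snd ℂ _ _ ∘ₗ Φ.toLinearMap

variable (Φ : E ≃ₗ[ℂ] symMatrix (Fin m) ℂ × symMatrix (Fin m) ℂ)

theorem coordFst_mem (v : E) : coordFst Φ v ∈ symMatrix (Fin m) ℂ := (Φ v).1.2

theorem coordSnd_mem (v : E) : coordSnd Φ v ∈ symMatrix (Fin m) ℂ := (Φ v).2.2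

theorem sum_half_single_smul {A : Type*} [CommRing A] [Algebra ℂ A] {M : Matrix (Fin m) (Fin m) A}
    (hM : M ∈ symMatrix (Fin m) A) (p q : Fin m) :
    ∑ i, ∑ j, ((2⁻¹ : ℂ) • (single i j 1 + single j i 1 : Matrix (Fin m) (Fin m) ℂ)) p q • M i j =
      M p q := by
  have hM' : M q p = M p q := congr_fun (congr_fun hM p) q
  have h1 : ∀ i j, ((2⁻¹ : ℂ) • (single i j 1 + single j i 1 : Matrix (Fin m) (Fin m) ℂ)) p q •
      M i j = (2⁻¹ : ℂ) • ((if i = p then if j = q then M i j else 0 else 0) +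
        (if i = q then if j = p then M i j else 0 else 0)) := by
    intro i j
    rw [Matrix.smul_apply, Matrix.add_apply, single_apply, single_apply, smul_assoc, add_smul]
    congr 2
    · simp [ite_and]
    · simp only [ite_smul, one_smul, zero_smul, ← ite_and, and_comm]
  simp_rw [h1, ← Finset.smul_sum, Finset.sum_add_distrib]
  simp only [Finset.sum_ite_irrel, Finset.sum_ite_eq', Finset.mem_univ, if_true,
    Finset.sum_const_zero, hM']
  rw [← two_smul ℂ, smul_smul, inv_mul_cancel₀ two_ne_zero, one_smul]

theorem single_half_mem (i j : Fin m) :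
    (2⁻¹ : ℂ) • (single i j 1 + single j i 1 : Matrix (Fin m) (Fin m) ℂ) ∈
      symMatrix (Fin m) ℂ :=
  Submodule.smul_mem _ _ (single_add_single_mem_symMatrix i j)

variable [FiniteDimensional ℂ E]

/-- Pairs of symmetric matrices over a `ℂ`-algebra `A` are the `A`-valued points of `E`. -/
theorem exists_algHom_genericMatrix {A : Type*} [CommRing A] [Algebra ℂ A]
    {M₁ M₂ : Matrix (Fin m) (Fin m) A} (h₁ : M₁ ∈ symMatrix (Fin m) A)
    (h₂ : M₂ ∈ symMatrix (Fin m) A) :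
    ∃ φ : coordRing E →ₐ[ℂ] A, (genericMatrix (coordFst Φ)).map φ = M₁ ∧
      (genericMatrix (coordSnd Φ)).map φ = M₂ := by
  let s : Fin m → Fin m → symMatrix (Fin m) ℂ := fun i j => ⟨_, single_half_mem i j⟩
  let ev (v : E) : Module.Dual ℂ E →ₗ[ℂ] ℂ := Module.Dual.eval ℂ E v
  let l : Module.Dual ℂ E →ₗ[ℂ] A :=
    ∑ i, ∑ j, ((ev (Φ.symm (s i j, 0))).smulRight (M₁ i j) +
      (ev (Φ.symm (0, s i j))).smulRight (M₂ i j))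
  obtain ⟨φ, hφ⟩ := exists_coordRing_lift l
  refine ⟨φ, ?_, ?_⟩
  · ext p q
    rw [map_apply, genericMatrix_apply, hφ, ← sum_half_single_smul h₁]
    simp only [l, LinearMap.sum_apply, LinearMap.add_apply, LinearMap.smulRight_apply, ev]
    simp [coordFst]
    rfl
  · ext p q
    rw [map_apply, genericMatrix_apply, hφ, ← sum_half_single_smul h₂]
    simp only [l, LinearMap.sum_apply, LinearMap.add_apply, LinearMap.smulRight_apply, ev]
    simp [coordSnd]
    rfl

omit [FiniteDimensional ℂ E] in
theorem adjoin_genericMatrix_eq_top :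
    Algebra.adjoin ℂ (Set.range fun a : Bool × Fin m × Fin m =>
      genericMatrix (if a.1 then coordFst Φ else coordSnd Φ) a.2.1 a.2.2) = ⊤ := by
  refine adjoin_linForm_eq_top (fun a : Bool × Fin m × Fin m => entryLinearMap ℂ ℂ a.2.1 a.2.2 ∘ₗ
    (if a.1 then coordFst Φ else coordSnd Φ)) fun x hx => Φ.injective ?_
  rw [map_zero]
  refine Prod.ext (Subtype.ext ?_) (Subtype.ext ?_)
  · ext i j
    exact hx (true, i, j)
  · ext i j
    exact hx (false, i, j)

omit [FiniteDimensional ℂ E] in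
theorem algHom_ext_genericMatrix {A : Type*} [CommRing A] [Algebra ℂ A]
    {φ ψ : coordRing E →ₐ[ℂ] A}
    (h₁ : (genericMatrix (coordFst Φ)).map φ = (genericMatrix (coordFst Φ)).map ψ)
    (h₂ : (genericMatrix (coordSnd Φ)).map φ = (genericMatrix (coordSnd Φ)).map ψ) : φ = ψ := by
  refine AlgHom.ext_of_adjoin_eq_top (adjoin_genericMatrix_eq_top Φ) ?_
  rintro _ ⟨⟨(_ | _), i, j⟩, rfl⟩
  · exact congr_fun (congr_fun h₂ i) j
  · exact congr_fun (congr_fun h₁ i) j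

omit [FiniteDimensional ℂ E] in
theorem derivation_comp_eq_zero {A : Type*} [CommRing A] [Algebra ℂ A] (φ : coordRing E →ₐ[ℂ] A)
    (D : Derivation ℂ A A) (h₁ : ((genericMatrix (coordFst Φ)).map φ).map D = 0)
    (h₂ : ((genericMatrix (coordSnd Φ)).map φ).map D = 0) (x : coordRing E) : D (φ x) = 0 := by
  have hx : x ∈ Algebra.adjoin ℂ (Set.range fun a : Bool × Fin m × Fin m =>
      genericMatrix (if a.1 then coordFst Φ else coordSnd Φ) a.2.1 a.2.2) := by
    rw [adjoin_genericMatrix_eq_top]; trivial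
  induction hx using Algebra.adjoin_induction with
  | mem x hx =>
    obtain ⟨⟨(_ | _), i, j⟩, rfl⟩ := hx
    · exact congr_fun (congr_fun h₂ i) j
    · exact congr_fun (congr_fun h₁ i) j
  | algebraMap r => rw [φ.commutes, D.map_algebraMap]
  | add x y _ _ hx hy => rw [map_add, map_add, hx, hy, add_zero]
  | mul x y _ _ hx hy => rw [map_mul, D.leibniz, hx, hy, smul_zero, smul_zero, add_zero]

/-- The height bound for the locus of a fibre of the commutator map at which neither coordinate is
regular. -/
theorem finrank_skewMatrix_add_two_le_height {L : Type*} [Field L] [Algebra ℂ L] [IsAlgClosed L]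
    (φ : coordRing E →ₐ[ℂ] L)
    (hs₁ : ¬ AdSurjective ((genericMatrix (coordFst Φ)).map φ))
    (hs₂ : ¬ AdSurjective ((genericMatrix (coordSnd Φ)).map φ))
    (hD : ∀ D : Derivation ℂ L L, ((genericMatrix (coordFst Φ)).map φ *
      (genericMatrix (coordSnd Φ)).map φ - (genericMatrix (coordSnd Φ)).map φ *
      (genericMatrix (coordFst Φ)).map φ).map D = 0) :
    (Module.finrank ℂ (skewMatrix (Fin m) ℂ) : ℕ∞) + 2 ≤ (RingHom.ker φ).height := by
  have : CharZero L := charZero_of_injective_algebraMap (algebraMap ℂ L).injective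
  have h₁ := map_mem_symMatrix (genericMatrix_mem_symMatrix (coordFst_mem Φ)) φ.toRingHom
  have h₂ := map_mem_symMatrix (genericMatrix_mem_symMatrix (coordSnd_mem Φ)) φ.toRingHom
  obtain ⟨ι, _, l, hl, hN⟩ := exists_algebraicIndependent_linForm φ
  classical
  choose D hDl using fun i => exists_derivation_apply_eq hl (Pi.single i 1 : ι → L)
  set τ := (mapDerivation ℂ ((genericMatrix (coordFst Φ)).map φ)).prod
    (mapDerivation ℂ ((genericMatrix (coordSnd Φ)).map φ))
  have hli : LinearIndependent L fun i => τ (D i) := by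
    rw [Fintype.linearIndependent_iff]
    intro c hc j
    have hc' : τ (∑ i, c i • D i) = 0 := by rw [← hc, map_sum]; simp
    have h0 := derivation_comp_eq_zero Φ φ (∑ i, c i • D i) (congr_arg Prod.fst hc')
      (congr_arg Prod.snd hc') (linForm (l j))
    rw [← Derivation.coeFnAddMonoidHom_apply, map_sum, Finset.sum_apply] at h0
    simpa [hDl, Pi.single_apply] using h0
  have hcard : Fintype.card ι ≤ Module.finrank L (LinearMap.range τ) := by
    have hli' : LinearIndependent L fun i => (⟨τ (D i), D i, rfl⟩ : LinearMap.range τ) :=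
      LinearIndependent.of_comp (LinearMap.range τ).subtype hli
    exact hli'.fintype_card_le_finrank
  have hT := finrank_range_prod_mapDerivation_add_two_le (k := ℂ) h₁ h₂ hs₁ hs₂ hD
  have hE : Module.finrank ℂ E = Module.finrank ℂ (symMatrix (Fin m) ℂ) +
      Module.finrank ℂ (symMatrix (Fin m) ℂ) := by
    rw [Φ.finrank_eq, Module.finrank_prod]
  have e1 := two_mul_finrank_symMatrix (Fin m) ℂ
  have e2 := two_mul_finrank_symMatrix (Fin m) L
  have e3 := finrank_symMatrix (Fin m) ℂ
  rw [Fintype.card_fin] at e1 e2 e3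
  have key : Module.finrank ℂ (skewMatrix (Fin m) ℂ) + 2 + Fintype.card ι ≤
      Module.finrank ℂ E := by
    change Module.finrank L (LinearMap.range τ) + 2 ≤ _ at hT
    omega
  have : ((Module.finrank ℂ (skewMatrix (Fin m) ℂ) : ℕ∞) + 2) + Fintype.card ι ≤
      (RingHom.ker φ).height + Fintype.card ι := le_trans (by exact_mod_cast key) hN
  exact (ENat.add_le_add_iff_right (ENat.natCast_ne_top _)).1 this

end GenericMatrix

section RegularFunctions

variable {m : ℕ}

/-- The elements `f` for which the image of `[G, ·]` on symmetric matrices contains `f` times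
every skew-symmetric matrix. -/
def regularFunctions {R : Type*} [CommRing R] (G : Matrix (Fin m) (Fin m) R) : Set R :=
  {f | ∃ H : Fin m → Fin m → Matrix (Fin m) (Fin m) R, (∀ i j, H i j ∈ symMatrix (Fin m) R) ∧
    ∀ i j, G * H i j - H i j * G = f • (single i j 1 - single j i 1)}

theorem sum_smul_single_sub_single {A : Type*} [CommRing A] {Z : Matrix (Fin m) (Fin m) A}
    (hZ : Z ∈ skewMatrix (Fin m) A) :
    ∑ i, ∑ j, Z i j • (single i j 1 - single j i 1 : Matrix (Fin m) (Fin m) A) = 2 • Z := by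
  have h1 : ∑ i, ∑ j, Z i j • (single i j 1 : Matrix (Fin m) (Fin m) A) = Z := by
    conv_rhs => rw [matrix_eq_sum_single Z]
    simp
  have h2 : ∑ i, ∑ j, Z i j • (single j i 1 : Matrix (Fin m) (Fin m) A) = Zᵀ := by
    conv_rhs => rw [matrix_eq_sum_single Zᵀ, Finset.sum_comm]
    simp
  simp_rw [smul_sub, Finset.sum_sub_distrib]
  rw [h1, h2, mem_skewMatrix.1 hZ, sub_neg_eq_add, two_smul]

/-- Solving `[G, X] = Z` over an algebra in which `f` becomes invertible; the solution has entries
in any ideal that contains the entries of `Z`. -/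
theorem exists_commutator_eq {R A : Type*} [CommRing R] [CommRing A] [Algebra ℂ A]
    {G : Matrix (Fin m) (Fin m) R} {f : R} (hf : f ∈ regularFunctions G) (φ : R →+* A)
    (hu : IsUnit (φ f)) {Z : Matrix (Fin m) (Fin m) A} (hZ : Z ∈ skewMatrix (Fin m) A)
    (I : Ideal A) (hI : ∀ i j, Z i j ∈ I) :
    ∃ X ∈ symMatrix (Fin m) A, G.map φ * X - X * G.map φ = Z ∧ ∀ i j, X i j ∈ I := by
  obtain ⟨H, hHs, hH⟩ := hf
  obtain ⟨v, hv⟩ := hu.exists_left_inv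
  let c : A := algebraMap ℂ A 2⁻¹ * v
  have hc : c * φ f * 2 = 1 := by
    rw [mul_assoc _ v, hv, mul_one, ← map_ofNat (algebraMap ℂ A) 2, ← map_mul,
      inv_mul_cancel₀ two_ne_zero, map_one]
  have hHφ : ∀ i j, G.map φ * (H i j).map φ - (H i j).map φ * G.map φ =
      φ f • (single i j 1 - single j i 1) := by
    intro i j
    rw [← Matrix.map_mul, ← Matrix.map_mul, ← Matrix.map_sub φ (by simp), hH]
    ext p q
    simp [single_apply, apply_ite φ]
  refine ⟨c • ∑ i, ∑ j, Z i j • (H i j).map φ, ?_, ?_, ?_⟩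
  · exact Submodule.smul_mem _ _ (Submodule.sum_mem _ fun i _ => Submodule.sum_mem _ fun j _ =>
      Submodule.smul_mem _ _ (map_mem_symMatrix (hHs i j) φ))
  · rw [mul_smul_comm, smul_mul_assoc, ← smul_sub, Finset.mul_sum, Finset.sum_mul,
      ← Finset.sum_sub_distrib]
    simp_rw [Finset.mul_sum, Finset.sum_mul, ← Finset.sum_sub_distrib, mul_smul_comm,
      smul_mul_assoc, ← smul_sub, hHφ]
    simp_rw [smul_comm _ (φ f), ← Finset.smul_sum]
    rw [sum_smul_single_sub_single hZ, smul_smul, ← Nat.cast_smul_eq_nsmul A, smul_smul]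
    rw [Nat.cast_ofNat, hc, one_smul]
  · intro p q
    rw [Matrix.smul_apply, Matrix.sum_apply]
    refine I.mul_mem_left _ (I.sum_mem fun i _ => ?_)
    rw [Matrix.sum_apply]
    refine I.sum_mem fun j _ => ?_
    rw [Matrix.smul_apply, smul_eq_mul]
    exact I.mul_mem_right _ (hI i j)

theorem adSurjective_of_regularFunctions {R L : Type*} [CommRing R] [Field L] [Algebra ℂ L]
    {G : Matrix (Fin m) (Fin m) R} {f : R} (hf : f ∈ regularFunctions G) (φ : R →+* L)
    (hφ : φ f ≠ 0) : AdSurjective (G.map φ) := by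
  intro Z hZ
  obtain ⟨X, hX, hXZ, -⟩ := exists_commutator_eq hf φ hφ.isUnit hZ ⊤ fun _ _ => trivial
  exact ⟨X, hX, hXZ⟩

theorem exists_det_submatrix_ne_zero {K τ σ : Type*} [Field K] [Fintype τ] [DecidableEq τ]
    [Fintype σ] (M : Matrix τ σ K) (hM : Function.Surjective M.mulVec) :
    ∃ s : τ → σ, (M.submatrix id s).det ≠ 0 := by
  obtain ⟨κ, a, ha, hspan, hli⟩ := exists_linearIndependent' K M.col
  have hfin : Finite κ := Finite.of_injective a ha
  have htop : Submodule.span K (Set.range M.col) = ⊤ := by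
    rw [← range_mulVecLin, LinearMap.range_eq_top]
    exact hM
  have _ := Fintype.ofFinite κ
  have hcard : Fintype.card κ = Fintype.card τ := by
    have := finrank_span_eq_card hli
    rw [hspan, htop, finrank_top, Module.finrank_fintype_fun_eq_card] at this
    exact this.symm
  let e : τ ≃ κ := (Fintype.equivOfCardEq hcard).symm
  refine ⟨a ∘ e, ?_⟩
  rw [← isUnit_iff_ne_zero, ← isUnit_iff_isUnit_det, ← linearIndependent_cols_iff_isUnit]
  exact hli.comp e e.injective

theorem eq_of_mem_skewMatrix {A : Type*} [CommRing A] [Algebra ℂ A]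
    {X Y : Matrix (Fin m) (Fin m) A} (hX : X ∈ skewMatrix (Fin m) A)
    (hY : Y ∈ skewMatrix (Fin m) A) (h : ∀ i j, i < j → X i j = Y i j) : X = Y := by
  have hdiag : ∀ W ∈ skewMatrix (Fin m) A, ∀ i, W i i = 0 := by
    intro W hW i
    have h1 : W i i = -W i i := congr_fun (congr_fun hW i) i
    have h2 : (2 : ℂ) • W i i = 0 := by
      rw [two_smul]
      exact add_eq_zero_iff_eq_neg.2 h1
    rw [← one_smul ℂ (W i i), ← inv_mul_cancel₀ (two_ne_zero (α := ℂ)), mul_smul, h2, smul_zero]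
  ext i j
  rcases lt_trichotomy i j with hij | rfl | hij
  · exact h i j hij
  · rw [hdiag X hX, hdiag Y hY]
  · have h1 : X i j = -X j i := congr_fun (congr_fun hX j) i
    have h2 : Y i j = -Y j i := congr_fun (congr_fun hY j) i
    rw [h1, h2, h j i hij]

/-- The matrix of `[G, ·]`, from the spanning set `Eᵢⱼ + Eⱼᵢ` of the symmetric matrices to the
entries above the diagonal. -/
def adMatrix {R : Type*} [CommRing R] (G : Matrix (Fin m) (Fin m) R) :
    Matrix {p : Fin m × Fin m // p.1 < p.2} (Fin m × Fin m) R :=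
  of fun t q => (G * (single q.1 q.2 1 + single q.2 q.1 1) -
    (single q.1 q.2 1 + single q.2 q.1 1) * G : Matrix (Fin m) (Fin m) R) t.1.1 t.1.2

theorem adMatrix_map {R S : Type*} [CommRing R] [CommRing S] (G : Matrix (Fin m) (Fin m) R)
    (φ : R →+* S) : adMatrix (G.map φ) = (adMatrix G).map φ := by
  ext t q
  have : (single q.1 q.2 1 + single q.2 q.1 1 : Matrix (Fin m) (Fin m) S) =
      (single q.1 q.2 1 + single q.2 q.1 1 : Matrix (Fin m) (Fin m) R).map φ := by
    ext i j
    simp [single_apply, apply_ite φ]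
  rw [adMatrix, of_apply, this, ← Matrix.map_mul, ← Matrix.map_mul, ← Matrix.map_sub φ (by simp)]
  rfl

theorem det_mem_regularFunctions {R : Type*} [CommRing R] [Algebra ℂ R]
    {G : Matrix (Fin m) (Fin m) R} (hG : G ∈ symMatrix (Fin m) R)
    (s : {p : Fin m × Fin m // p.1 < p.2} → Fin m × Fin m) :
    ((adMatrix G).submatrix id s).det ∈ regularFunctions G := by
  set N := (adMatrix G).submatrix id s with hN
  let K (t : {p : Fin m × Fin m // p.1 < p.2}) : Matrix (Fin m) (Fin m) R :=
    ∑ t', N.adjugate t' t • (single (s t').1 (s t').2 1 + single (s t').2 (s t').1 1)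
  have hKs : ∀ t, K t ∈ symMatrix (Fin m) R := fun t => Submodule.sum_mem _ fun t' _ =>
    Submodule.smul_mem _ _ (by
      rw [mem_symMatrix, transpose_add, transpose_single, transpose_single, add_comm])
  have hskew : ∀ i j : Fin m, (single i j 1 - single j i 1 : Matrix (Fin m) (Fin m) R) ∈
      skewMatrix (Fin m) R := by
    intro i j
    rw [mem_skewMatrix, transpose_sub, transpose_single, transpose_single, neg_sub]
  have hK : ∀ t, G * K t - K t * G =
      N.det • (single t.1.1 t.1.2 1 - single t.1.2 t.1.1 1) := by
    intro t
    refine eq_of_mem_skewMatrix (commutator_mem_skewMatrix hG (hKs t))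
      (Submodule.smul_mem _ _ (hskew _ _)) fun i j hij => ?_
    have h1 := congr_fun (congr_fun (mul_adjugate N) ⟨(i, j), hij⟩) t
    have h2 : (G * K t - K t * G) i j = (N * N.adjugate) ⟨(i, j), hij⟩ t := by
      simp only [K, Finset.mul_sum, Finset.sum_mul, ← Finset.sum_sub_distrib, mul_smul_comm,
        smul_mul_assoc, ← smul_sub, Matrix.sum_apply, Matrix.smul_apply, Matrix.mul_apply (M := N), smul_eq_mul]
      exact Finset.sum_congr rfl fun t' _ => mul_comm _ _
    rw [h2, h1, Matrix.smul_apply, Matrix.smul_apply]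
    congr 1
    obtain ⟨⟨p, q⟩, hpq⟩ := t
    have h3 : ¬(i = q ∧ j = p) := fun h => lt_asymm hij (h.1 ▸ h.2 ▸ hpq)
    simp [Matrix.one_apply, single_apply, h3, eq_comm]
  refine ⟨fun i j => if h : i < j then K ⟨(i, j), h⟩ else if h : j < i then -K ⟨(j, i), h⟩ else 0,
    fun i j => ?_, fun i j => ?_⟩
  · dsimp only
    split_ifs
    · exact hKs _
    · exact Submodule.neg_mem _ (hKs _)
    · exact Submodule.zero_mem _
  · rcases lt_trichotomy i j with hij | rfl | hij
    · simp only [hij, dif_pos]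
      exact hK _
    · simp
    · simp only [hij, not_lt_of_gt hij, dif_pos, dif_neg, not_false_eq_true]
      rw [mul_neg, neg_mul, sub_neg_eq_add, neg_add_eq_sub, ← neg_sub, hK, ← smul_neg, neg_sub]

theorem exists_regularFunctions_ne_zero {R L : Type*} [CommRing R] [Algebra ℂ R] [Field L]
    [CharZero L] {G : Matrix (Fin m) (Fin m) R} (hG : G ∈ symMatrix (Fin m) R) (φ : R →+* L)
    (h : AdSurjective (G.map φ)) : ∃ f ∈ regularFunctions G, φ f ≠ 0 := by
  obtain ⟨s, hs⟩ := exists_det_submatrix_ne_zero (adMatrix (G.map φ)) fun w => by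
    let Z : Matrix (Fin m) (Fin m) L := of fun i j =>
      if h : i < j then w ⟨(i, j), h⟩ else if h : j < i then -w ⟨(j, i), h⟩ else 0
    have hZ : Z ∈ skewMatrix (Fin m) L := by
      ext i j
      rcases lt_trichotomy i j with hij | rfl | hij
      · simp [Z, hij, not_lt_of_gt hij]
      · simp [Z]
      · simp [Z, hij, not_lt_of_gt hij]
    obtain ⟨A, hA, hAZ⟩ := h Z hZ
    refine ⟨fun q => 2⁻¹ * A q.1 q.2, ?_⟩
    have hsum : ∑ q : Fin m × Fin m, (2⁻¹ * A q.1 q.2) •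
        (single q.1 q.2 1 + single q.2 q.1 1 : Matrix (Fin m) (Fin m) L) = A := by
      have h1 : ∑ i, ∑ j, A i j • (single i j 1 : Matrix (Fin m) (Fin m) L) = A := by
        conv_rhs => rw [matrix_eq_sum_single A]
        simp
      have h2 : ∑ i, ∑ j, A i j • (single j i 1 : Matrix (Fin m) (Fin m) L) = A := by
        conv_rhs => rw [← mem_symMatrix.1 hA, matrix_eq_sum_single Aᵀ, Finset.sum_comm]
        simp
      simp_rw [Fintype.sum_prod_type, mul_smul, ← Finset.smul_sum, smul_add,
        Finset.sum_add_distrib]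
      rw [h1, h2, ← two_smul L A, smul_smul, inv_mul_cancel₀ two_ne_zero, one_smul]
    funext t
    have h3 : Z t.1.1 t.1.2 = w t := by simp [Z, t.2]
    rw [← h3, ← hAZ]
    conv_rhs => rw [← hsum]
    simp only [mulVec, dotProduct, adMatrix, of_apply, Finset.mul_sum, Finset.sum_mul,
      ← Finset.sum_sub_distrib, mul_smul_comm, smul_mul_assoc, ← smul_sub, Matrix.sum_apply,
      Matrix.smul_apply, smul_eq_mul]
    exact Finset.sum_congr rfl fun q _ => mul_comm _ _
  refine ⟨_, det_mem_regularFunctions hG s, ?_⟩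
  rw [RingHom.map_det]
  rwa [adMatrix_map] at hs

end RegularFunctions

section LiftingCriterion

theorem smooth_away_of_exists_lift {k : Type*} {S R : Type u} [CommRing k] [CommRing S] [CommRing R]
    [Algebra k S] [Algebra k R] [Algebra.FiniteType k S] [Algebra.FinitePresentation k R]
    (θ : S →ₐ[k] R) (f : R)
    (hlift : ∀ (A : Type u) [CommRing A] [Algebra k A] (I : Ideal A), IsNilpotent I →
      ∀ (σ : S →ₐ[k] A) (g : R →ₐ[k] A ⧸ I), IsUnit (g f) →
        (∀ y, g (θ y) = Ideal.Quotient.mk I (σ y)) →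
          ∃ φ : R →ₐ[k] A, (∀ y, φ (θ y) = σ y) ∧ ∀ x, Ideal.Quotient.mk I (φ x) = g x) :
    ((algebraMap R (Localization.Away f)).comp θ.toRingHom).Smooth := by
  let _ : Algebra S (Localization.Away f) :=
    ((algebraMap R (Localization.Away f)).comp θ.toRingHom).toAlgebra
  have : IsScalarTower k S (Localization.Away f) := .of_algebraMap_eq fun r => by
    change _ = algebraMap R (Localization.Away f) (θ (algebraMap k S r))
    rw [θ.commutes, ← IsScalarTower.algebraMap_apply]
  have hfp : Algebra.FinitePresentation k (Localization.Away f) :=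
    have : Algebra.FinitePresentation R (Localization.Away f) :=
      IsLocalization.Away.finitePresentation f
    .trans k R _
  have hfp' : Algebra.FinitePresentation S (Localization.Away f) :=
    .of_restrict_scalars_finitePresentation k _ _
  have hfs : Algebra.FormallySmooth S (Localization.Away f) := by
    refine .of_comp_surjective fun A _ _ I hI g => ?_
    let _ : Algebra k A := ((algebraMap S A).comp (algebraMap k S)).toAlgebra
    have hst : IsScalarTower k S A := .of_algebraMap_eq fun r => rfl
    let g' : R →ₐ[k] A ⧸ I :=
      { g.toRingHom.comp (algebraMap R (Localization.Away f)) with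
        commutes' := fun r => by
          change g (algebraMap R _ (algebraMap k R r)) = _
          rw [← θ.commutes]
          exact g.commutes (algebraMap k S r) }
    obtain ⟨φ, hφ₁, hφ₂⟩ := hlift A I ⟨2, hI⟩
      (IsScalarTower.toAlgHom k S A) g'
      ((IsLocalization.Away.algebraMap_isUnit f).map g.toRingHom) (fun y => g.commutes y)
    have hu : IsUnit (φ f) := by
      rw [← IsNilpotent.isUnit_quotient_mk_iff (I := I) ⟨2, hI⟩, hφ₂]
      exact (IsLocalization.Away.algebraMap_isUnit f).map g.toRingHom
    let φ' : Localization.Away f →+* A := IsLocalization.Away.lift f (g := φ.toRingHom) hu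
    have hφ' : ∀ x, φ' (algebraMap R _ x) = φ x := fun x => IsLocalization.Away.lift_eq f hu x
    refine ⟨{ φ' with commutes' := fun y => ?_ }, ?_⟩
    · exact (hφ' _).trans (hφ₁ y)
    · refine AlgHom.coe_ringHom_injective ?_
      refine IsLocalization.ringHom_ext (Submonoid.powers f) (RingHom.ext fun x => ?_)
      change Ideal.Quotient.mk I (φ' (algebraMap R _ x)) = g (algebraMap R _ x)
      rw [hφ', hφ₂]
      rfl
  exact RingHom.smooth_def.2 ⟨hfs, hfp'⟩

end LiftingCriterion

section Smoothness

variable {E T : Type u} [AddCommGroup E] [Module ℂ E] [AddCommGroup T] [Module ℂ T] {m : ℕ}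

/-- Symmetric matrices over a quotient lift to symmetric matrices. -/
theorem exists_symMatrix_lift {A : Type*} [CommRing A] [Algebra ℂ A] (I : Ideal A)
    {M : Matrix (Fin m) (Fin m) (A ⧸ I)} (hM : M ∈ symMatrix (Fin m) (A ⧸ I)) :
    ∃ N ∈ symMatrix (Fin m) A, N.map (Ideal.Quotient.mk I) = M := by
  choose N hN using fun i j => Ideal.Quotient.mk_surjective (I := I) (M i j)
  refine ⟨(2⁻¹ : ℂ) • (of N + (of N)ᵀ), ?_, ?_⟩
  · rw [mem_symMatrix, transpose_smul, transpose_add, transpose_transpose, add_comm]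
  · ext i j
    have h : M j i = M i j := congr_fun (congr_fun hM i) j
    have h1 : ∀ x : A, Ideal.Quotient.mk I ((2⁻¹ : ℂ) • x) = (2⁻¹ : ℂ) • Ideal.Quotient.mk I x :=
      fun x => rfl
    rw [map_apply, Matrix.smul_apply, h1, Matrix.add_apply, transpose_apply, of_apply, of_apply,
      map_add, hN, hN, h, ← two_smul ℂ, smul_smul, inv_mul_cancel₀ two_ne_zero, one_smul]

variable (Φ : E ≃ₗ[ℂ] symMatrix (Fin m) ℂ × symMatrix (Fin m) ℂ)
  (Ψ : T ≃ₗ[ℂ] skewMatrix (Fin m) ℂ) {c : E → T} (hc : IsPolynomialMap c)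

/-- A vector of `T`, as a matrix. -/
def coordMatrix : T →ₗ[ℂ] Matrix (Fin m) (Fin m) ℂ :=
  (skewMatrix (Fin m) ℂ).subtype ∘ₗ Ψ.toLinearMap

theorem coordMatrix_mem (v : T) : coordMatrix Ψ v ∈ skewMatrix (Fin m) ℂ := (Ψ v).2

theorem adjoin_genericMatrix_coordMatrix_eq_top :
    Algebra.adjoin ℂ (Set.range fun a : Fin m × Fin m =>
      genericMatrix (coordMatrix Ψ) a.1 a.2) = ⊤ := by
  refine adjoin_linForm_eq_top (fun a : Fin m × Fin m => entryLinearMap ℂ ℂ a.1 a.2 ∘ₗ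
    coordMatrix Ψ) fun x hx => Ψ.injective ?_
  rw [map_zero]
  refine Subtype.ext ?_
  ext i j
  exact hx (i, j)

theorem genericMatrix_map_comorphism
    (hcomm : ∀ x, coordMatrix Ψ (c x) =
      coordFst Φ x * coordSnd Φ x - coordSnd Φ x * coordFst Φ x) :
    (genericMatrix (coordMatrix Ψ)).map (comorphism c hc) =
      genericMatrix (coordFst Φ) * genericMatrix (coordSnd Φ) -
        genericMatrix (coordSnd Φ) * genericMatrix (coordFst Φ) := by
  refine Matrix.ext fun i j => coordRing_ext fun v => ?_
  have h1 : evalAt v ((genericMatrix (coordMatrix Ψ)).map (comorphism c hc) i j) =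
      coordMatrix Ψ (c v) i j := rfl
  rw [h1, hcomm, Matrix.sub_apply, Matrix.sub_apply, map_sub, Matrix.mul_apply, Matrix.mul_apply,
    Matrix.mul_apply, Matrix.mul_apply, map_sum, map_sum]
  rfl

theorem comorphism_algebraMap (r : ℂ) :
    comorphism c hc (algebraMap ℂ (coordRing T) r) = algebraMap ℂ (coordRing E) r := rfl

variable [FiniteDimensional ℂ E]

/-- The lifting property of the commutator morphism over the locus where the first coordinate is
regular. -/
theorem exists_lift_of_regularFunctions
    (hcomm : ∀ x, coordMatrix Ψ (c x) =
      coordFst Φ x * coordSnd Φ x - coordSnd Φ x * coordFst Φ x)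
    {f : coordRing E} (hf : f ∈ regularFunctions (genericMatrix (coordFst Φ)))
    {A : Type*} [CommRing A] [Algebra ℂ A] (I : Ideal A) (hI : IsNilpotent I)
    (σ : coordRing T →ₐ[ℂ] A) (g : coordRing E →ₐ[ℂ] A ⧸ I) (hg : IsUnit (g f))
    (hσ : ∀ y, g (comorphism c hc y) = Ideal.Quotient.mk I (σ y)) :
    ∃ φ : coordRing E →ₐ[ℂ] A, (∀ y, φ (comorphism c hc y) = σ y) ∧
      ∀ x, Ideal.Quotient.mk I (φ x) = g x := by
  have hs₁ := genericMatrix_mem_symMatrix (coordFst_mem Φ)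
  have hs₂ := genericMatrix_mem_symMatrix (coordSnd_mem Φ)
  obtain ⟨M₁, hM₁, hM₁g⟩ := exists_symMatrix_lift I (map_mem_symMatrix hs₁ g.toRingHom)
  obtain ⟨M₂, hM₂, hM₂g⟩ := exists_symMatrix_lift I (map_mem_symMatrix hs₂ g.toRingHom)
  obtain ⟨φ₀, hφ₁, hφ₂⟩ := exists_algHom_genericMatrix Φ hM₁ hM₂
  have hφ₀ : (Ideal.Quotient.mkₐ ℂ I).comp φ₀ = g := by
    refine algHom_ext_genericMatrix Φ ?_ ?_
    · rw [← show _ = (genericMatrix (coordFst Φ)).map g from hM₁g, ← hφ₁]; rfl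
    · rw [← show _ = (genericMatrix (coordSnd Φ)).map g from hM₂g, ← hφ₂]; rfl
  have hu : IsUnit (φ₀ f) := by
    rw [← hI.isUnit_quotient_mk_iff]
    have : Ideal.Quotient.mk I (φ₀ f) = g f := AlgHom.congr_fun hφ₀ f
    rwa [this]
  set Y := (genericMatrix (coordMatrix Ψ)).map σ with hY
  have hYs : Y ∈ skewMatrix (Fin m) A :=
    map_mem_skewMatrix (genericMatrix_mem_skewMatrix (coordMatrix_mem Ψ)) σ.toRingHom
  have hYg : Y.map (Ideal.Quotient.mk I) = (M₁ * M₂ - M₂ * M₁).map (Ideal.Quotient.mk I) := by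
    have h1 : Y.map (Ideal.Quotient.mk I) =
        ((genericMatrix (coordMatrix Ψ)).map (comorphism c hc)).map g :=
      Matrix.ext fun i j => (hσ _).symm
    rw [h1, genericMatrix_map_comorphism Φ Ψ hc hcomm, Matrix.map_sub _ (by simp),
      Matrix.map_mul, Matrix.map_mul, Matrix.map_sub _ (by simp), Matrix.map_mul,
      Matrix.map_mul, hM₁g, hM₂g]
    rfl
  obtain ⟨X, hX, hXZ, hXI⟩ := exists_commutator_eq hf φ₀.toRingHom hu
    (Submodule.sub_mem _ hYs (commutator_mem_skewMatrix hM₁ hM₂)) I fun i j => by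
      rw [← Ideal.Quotient.eq_zero_iff_mem, Matrix.sub_apply, map_sub, sub_eq_zero]
      exact congr_fun (congr_fun hYg i) j
  obtain ⟨φ, hφ₁', hφ₂'⟩ := exists_algHom_genericMatrix Φ hM₁ (Submodule.add_mem _ hM₂ hX)
  refine ⟨φ, fun y => ?_, fun x => ?_⟩
  · have hy : y ∈ Algebra.adjoin ℂ (Set.range fun a : Fin m × Fin m =>
        genericMatrix (coordMatrix Ψ) a.1 a.2) := by
      rw [adjoin_genericMatrix_coordMatrix_eq_top]; trivial
    induction hy using Algebra.adjoin_induction with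
    | mem y hy =>
      obtain ⟨⟨i, j⟩, rfl⟩ := hy
      have h1 : ((genericMatrix (coordMatrix Ψ)).map (comorphism c hc)).map φ = Y := by
        rw [genericMatrix_map_comorphism Φ Ψ hc hcomm, Matrix.map_sub _ (by simp),
          Matrix.map_mul, Matrix.map_mul, hφ₁', hφ₂', mul_add, add_mul, add_sub_add_comm]
        rw [show M₁ * X - X * M₁ = Y - (M₁ * M₂ - M₂ * M₁) by rw [← hXZ, ← hφ₁]; rfl]
        abel
      exact congr_fun (congr_fun h1 i) j
    | algebraMap r => rw [comorphism_algebraMap, φ.commutes, σ.commutes]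
    | add x y _ _ hx hy => rw [map_add, map_add, map_add, hx, hy]
    | mul x y _ _ hx hy => rw [map_mul, map_mul, map_mul, hx, hy]
  · have hφ : (Ideal.Quotient.mkₐ ℂ I).comp φ = (Ideal.Quotient.mkₐ ℂ I).comp φ₀ := by
      refine algHom_ext_genericMatrix Φ ?_ ?_
      · change ((genericMatrix (coordFst Φ)).map φ).map (Ideal.Quotient.mk I) =
          ((genericMatrix (coordFst Φ)).map φ₀).map (Ideal.Quotient.mk I)
        rw [hφ₁, hφ₁']
      · change ((genericMatrix (coordSnd Φ)).map φ).map (Ideal.Quotient.mk I) =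
          ((genericMatrix (coordSnd Φ)).map φ₀).map (Ideal.Quotient.mk I)
        rw [hφ₂, hφ₂']
        ext i j
        rw [map_apply, map_apply, Matrix.add_apply, map_add,
          Ideal.Quotient.eq_zero_iff_mem.2 (hXI i j), add_zero]
    rw [← hφ₀, ← hφ]
    rfl

variable [FiniteDimensional ℂ T]

theorem smooth_of_regularFunctions
    (hcomm : ∀ x, coordMatrix Ψ (c x) =
      coordFst Φ x * coordSnd Φ x - coordSnd Φ x * coordFst Φ x)
    {f : coordRing E} (hf : f ∈ regularFunctions (genericMatrix (coordFst Φ))) :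
    ((algebraMap (coordRing E) (Localization.Away f)).comp (comorphism c hc)).Smooth :=
  smooth_away_of_exists_lift (k := ℂ)
    { comorphism c hc with commutes' := comorphism_algebraMap hc } f
    fun _ _ _ I hI σ g hg hσ => exists_lift_of_regularFunctions Φ Ψ hc hcomm hf I hI σ g hg hσ

end Smoothness

section Codimension

theorem le_codimension {R Y : Type*} [CommRing R] (I : Ideal R) [TopologicalSpace Y]
    [QuasiSober Y] {j : Y → PrimeSpectrum R} (hj : Topology.IsInducing j)
    (hrange : Set.range j = PrimeSpectrum.zeroLocus I) {Z : Set Y} {n : ℕ∞}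
    (hZ : ∀ y ∈ Z, n ≤ ((j y).asIdeal.map (Ideal.Quotient.mk I)).height) :
    n ≤ codimension Z := by
  refine le_iInf₂ fun T hT => ?_
  have hmem : ∀ q : PrimeSpectrum (R ⧸ I),
      ∃ y, j y = PrimeSpectrum.comap (Ideal.Quotient.mk I) q := fun q => by
    rw [← Set.mem_range, hrange, PrimeSpectrum.mem_zeroLocus]
    intro x hx
    rw [SetLike.mem_coe, PrimeSpectrum.comap_asIdeal, Ideal.mem_comap,
      Ideal.Quotient.eq_zero_iff_mem.2 hx]
    exact zero_mem _
  choose s hs using hmem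
  have hle : ∀ q q' : PrimeSpectrum (R ⧸ I),
      closure {s q'} ⊆ closure {s q} ↔ q ≤ q' := fun q q' => by
    rw [← specializes_iff_closure_subset, ← hj.specializes_iff, hs, hs,
      ← PrimeSpectrum.le_iff_specializes]
    exact Ideal.comap_le_comap_iff_of_surjective _ Ideal.Quotient.mk_surjective _ _
  let F : (PrimeSpectrum (R ⧸ I))ᵒᵈ → IrreducibleCloseds Y := fun q =>
    ⟨closure {s (OrderDual.ofDual q)}, isIrreducible_singleton.closure, isClosed_closure⟩
  have hF : StrictMono F := fun q q' hq => by
    have hq' : OrderDual.ofDual q' < OrderDual.ofDual q := hq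
    rw [lt_iff_le_not_ge] at hq' ⊢
    exact ⟨(hle _ _).2 hq'.1, fun h => hq'.2 ((hle _ _).1 h)⟩
  obtain ⟨y, hy⟩ := QuasiSober.sober T.isIrreducible T.isClosed
  have hyT : closure {y} = (T : Set Y) := hy
  have hyI : I ≤ (j y).asIdeal := by
    have := hrange.le ⟨y, rfl⟩
    exact this
  have hprime : ((j y).asIdeal.map (Ideal.Quotient.mk I)).IsPrime :=
    Ideal.map_isPrime_of_surjective Ideal.Quotient.mk_surjective
      (by rwa [Ideal.mk_ker])
  let q : PrimeSpectrum (R ⧸ I) := ⟨_, hprime⟩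
  have hq : j (s q) = j y := by
    rw [hs]
    refine PrimeSpectrum.ext ?_
    rw [PrimeSpectrum.comap_asIdeal, Ideal.comap_map_of_surjective _ Ideal.Quotient.mk_surjective,
      ← RingHom.ker_eq_comap_bot, Ideal.mk_ker, sup_eq_left.2 hyI]
  have hFq : F (OrderDual.toDual q) = T := by
    refine IrreducibleCloseds.ext (Eq.trans ?_ hyT)
    have hi : Inseparable (s q) y := by rw [← hj.inseparable_iff, hq]
    exact inseparable_iff_closure_eq.1 hi
  calc n ≤ q.asIdeal.height := hZ y (hT (hyT ▸ subset_closure rfl))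
    _ = Order.coheight (OrderDual.toDual q) := by
      rw [PrimeSpectrum.height_eq_orderHeight, Order.coheight_toDual]
    _ ≤ Order.coheight T := hFq ▸ Order.coheight_le_coheight_apply_of_strictMono F hF _

end Codimension

section Fibre

theorem preimage_pt_eq_zeroLocus {E T : Type u} [AddCommGroup E] [Module ℂ E] [AddCommGroup T]
    [Module ℂ T] {c : E → T} (hc : IsPolynomialMap c) (X : T) :
    (affineMap c hc) ⁻¹' {pt X} =
      (PrimeSpectrum.zeroLocus ((RingHom.ker (evalAt X)).map (comorphism c hc)) :
        Set (PrimeSpectrum (coordRing E))) := by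
  ext (x : PrimeSpectrum (coordRing E))
  have h1 : x ∈ PrimeSpectrum.zeroLocus
      ((RingHom.ker (evalAt X)).map (comorphism c hc) : Set (coordRing E)) ↔
      RingHom.ker (evalAt X) ≤ x.asIdeal.comap (comorphism c hc) := by
    rw [PrimeSpectrum.mem_zeroLocus, SetLike.coe_subset_coe, Ideal.map_le_iff_le_comap]
  refine Iff.trans ?_ h1.symm
  have h2 : x ∈ (affineMap c hc) ⁻¹' {pt X} ↔
      PrimeSpectrum.comap (comorphism c hc) x =
        ⟨RingHom.ker (evalAt X), RingHom.ker_isPrime _⟩ := Iff.rfl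
  refine h2.trans ?_
  rw [PrimeSpectrum.ext_iff]
  refine ⟨fun h => h.ge, fun h => ?_⟩
  exact ((inferInstance : (RingHom.ker (evalAt X)).IsMaximal).eq_of_le
    ((Ideal.IsPrime.comap (comorphism c hc)).ne_top) h).symm

theorem smooth_fiber_of_smooth_restrict {X Y : Scheme.{u}} (m : X ⟶ Y) (U : X.Opens)
    (h : Smooth (U.ι ≫ m)) (y : Y) :
    Smooth ((m.fiberι y ⁻¹ᵁ U).ι ≫ m.fiberToSpecResidueField y) := by
  have h1 := isPullback_morphismRestrict (m.fiberι y) U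
  have h2 : IsPullback (m.fiberι y) (m.fiberToSpecResidueField y) m (Y.fromSpecResidueField y) :=
    IsPullback.of_hasPullback m (Y.fromSpecResidueField y)
  exact MorphismProperty.of_isPullback (P := @Smooth) (h1.paste_vert h2) h

theorem smooth_restrict_iSup {X Y : Scheme.{u}} (m : X ⟶ Y) [LocallyOfFinitePresentation m]
    {ι : Type*} (U : ι → X.Opens) (h : ∀ i, Smooth ((U i).ι ≫ m)) :
    Smooth ((⨆ i, U i).ι ≫ m) := by
  rw [← Scheme.Hom.smoothLocus_eq_top_iff, ← Scheme.Hom.preimage_smoothLocus_eq]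
  have key : ∀ V : X.Opens, V.ι ⁻¹ᵁ m.smoothLocus = ⊤ ↔ V ≤ m.smoothLocus := fun V => by
    refine ⟨fun hV x hx => ?_, fun hV => top_le_iff.1 fun x _ => hV x.2⟩
    exact hV.ge (Set.mem_univ (⟨x, hx⟩ : V))
  rw [key]
  refine iSup_le fun i => (key _).1 ?_
  rw [Scheme.Hom.preimage_smoothLocus_eq, Scheme.Hom.smoothLocus_eq_top_iff]
  exact h i

end Fibre

/-- Every prime ideal is the kernel of a homomorphism to an algebraically closed field. -/
theorem exists_algHom_isAlgClosed_ker_eq {k : Type*} {R : Type u} [Field k] [CommRing R]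
    [Algebra k R] (P : Ideal R) [P.IsPrime] :
    ∃ (L : Type u) (_ : Field L) (_ : Algebra k L) (_ : IsAlgClosed L) (φ : R →ₐ[k] L),
      RingHom.ker φ = P := by
  refine ⟨AlgebraicClosure (FractionRing (R ⧸ P)), inferInstance, inferInstance, inferInstance,
    (IsScalarTower.toAlgHom k (R ⧸ P) _).comp (Ideal.Quotient.mkₐ k P), ?_⟩
  ext x
  have h : Function.Injective
      (algebraMap (R ⧸ P) (AlgebraicClosure (FractionRing (R ⧸ P)))) := by
    rw [IsScalarTower.algebraMap_eq (R ⧸ P) (FractionRing (R ⧸ P))]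
    exact (algebraMap (FractionRing (R ⧸ P)) _).injective.comp (IsFractionRing.injective _ _)
  rw [RingHom.mem_ker]
  refine Iff.trans ?_ Ideal.Quotient.eq_zero_iff_mem
  exact map_eq_zero_iff (algebraMap (R ⧸ P) (AlgebraicClosure (FractionRing (R ⧸ P)))) h

section CommutatorMorphism

variable {E T : Type u} [AddCommGroup E] [Module ℂ E] [AddCommGroup T] [Module ℂ T] {m : ℕ}
  [FiniteDimensional ℂ E] [FiniteDimensional ℂ T]
  (Φ : E ≃ₗ[ℂ] symMatrix (Fin m) ℂ × symMatrix (Fin m) ℂ)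
  (Ψ : T ≃ₗ[ℂ] skewMatrix (Fin m) ℂ) {c : E → T} (hc : IsPolynomialMap c)
  (hcomm : ∀ x, coordMatrix Ψ (c x) =
    coordFst Φ x * coordSnd Φ x - coordSnd Φ x * coordFst Φ x)

include Ψ hcomm in
theorem smooth_of_regularFunctions_coordSnd {f : coordRing E}
    (hf : f ∈ regularFunctions (genericMatrix (coordSnd Φ))) :
    ((algebraMap (coordRing E) (Localization.Away f)).comp (comorphism c hc)).Smooth := by
  refine smooth_of_regularFunctions (Φ.trans (LinearEquiv.prodComm ℂ _ _))
    (Ψ.trans (LinearEquiv.neg ℂ)) hc (fun x => ?_) hf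
  exact (congr_arg Neg.neg (hcomm x)).trans (neg_sub _ _)

include hcomm in
theorem two_le_height_map (X : T) (P : Ideal (coordRing E)) [P.IsPrime]
    (hP : (RingHom.ker (evalAt X)).map (comorphism c hc) ≤ P)
    (h₁ : ∀ f ∈ regularFunctions (genericMatrix (coordFst Φ)), f ∈ P)
    (h₂ : ∀ f ∈ regularFunctions (genericMatrix (coordSnd Φ)), f ∈ P) :
    2 ≤ (P.map (Ideal.Quotient.mk
      ((RingHom.ker (evalAt X)).map (comorphism c hc)))).height := by
  set I := (RingHom.ker (evalAt X)).map (comorphism c hc)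
  obtain ⟨L, _, _, _, φ, hφ⟩ := exists_algHom_isAlgClosed_ker_eq (k := ℂ) P
  have : CharZero L := charZero_of_injective_algebraMap (algebraMap ℂ L).injective
  have hφI : ∀ y, φ (comorphism c hc y) = algebraMap ℂ L (evalAt X y) := fun y => by
    have h : comorphism c hc (y - algebraMap ℂ (coordRing T) (evalAt X y)) ∈ RingHom.ker φ := by
      rw [hφ]
      refine hP (Ideal.mem_map_of_mem _ ?_)
      rw [RingHom.mem_ker, map_sub, evalAt_algebraMap, sub_self]
    rwa [RingHom.mem_ker, map_sub, comorphism_algebraMap, map_sub, φ.commutes, sub_eq_zero] at h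
  have hle : (Module.finrank ℂ (skewMatrix (Fin m) ℂ) : ℕ∞) + 2 ≤ P.height := by
    rw [← hφ]
    refine finrank_skewMatrix_add_two_le_height Φ φ (fun h => ?_) (fun h => ?_) fun D => ?_
    · obtain ⟨f, hf, hφf⟩ := exists_regularFunctions_ne_zero
        (genericMatrix_mem_symMatrix (coordFst_mem Φ)) φ.toRingHom h
      exact hφf (RingHom.mem_ker.1 (hφ.symm ▸ h₁ f hf : f ∈ RingHom.ker φ))
    · obtain ⟨f, hf, hφf⟩ := exists_regularFunctions_ne_zero
        (genericMatrix_mem_symMatrix (coordSnd_mem Φ)) φ.toRingHom h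
      exact hφf (RingHom.mem_ker.1 (hφ.symm ▸ h₂ f hf : f ∈ RingHom.ker φ))
    · rw [← Matrix.map_mul, ← Matrix.map_mul, ← Matrix.map_sub _ (map_sub φ),
        ← genericMatrix_map_comorphism Φ Ψ hc hcomm]
      ext i j
      change D (φ (comorphism c hc _)) = 0
      rw [hφI, D.map_algebraMap]
  have hI : I.spanFinrank ≤ Module.finrank ℂ (skewMatrix (Fin m) ℂ) :=
    (spanFinrank_map_ker_evalAt_le (comorphism c hc) X).trans_eq Ψ.finrank_eq
  have h := hle.trans (Ideal.height_le_height_add_spanFinrank_of_le hP)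
  rw [add_comm] at h
  rw [add_comm] at h
  refine (ENat.add_le_add_iff_left (ENat.natCast_ne_top _)).1 (h.trans ?_)
  rw [add_comm]
  gcongr

omit [FiniteDimensional ℂ E] [FiniteDimensional ℂ T] in
theorem smooth_basicOpen_ι_comp_affineMap {f : coordRing E}
    (hf : ((algebraMap (coordRing E) (Localization.Away f)).comp (comorphism c hc)).Smooth) :
    Smooth (Scheme.Opens.ι (X := affine E) (PrimeSpectrum.basicOpen f) ≫ affineMap c hc) := by
  have h : Smooth (Spec.map (CommRingCat.ofHom
      ((algebraMap (coordRing E) (Localization.Away f)).comp (comorphism c hc)))) :=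
    (HasRingHomProperty.Spec_iff (P := @Smooth)).2 hf
  rw [CommRingCat.ofHom_comp, Spec.map_comp] at h
  have h' := MorphismProperty.comp_mem @Smooth
    (basicOpenIsoSpecAway (R := CommRingCat.of (coordRing E)) f).hom _ inferInstance h
  rw [basicOpenIsoSpecAway_hom_SpecMap_assoc] at h'
  exact h'

theorem locallyOfFinitePresentation_affineMap : LocallyOfFinitePresentation (affineMap c hc) := by
  refine (HasRingHomProperty.Spec_iff (P := @LocallyOfFinitePresentation)).2 ?_
  let _ : Algebra (coordRing T) (coordRing E) := (comorphism c hc).toAlgebra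
  have : IsScalarTower ℂ (coordRing T) (coordRing E) :=
    .of_algebraMap_eq fun r => (comorphism_algebraMap hc r).symm
  exact Algebra.FinitePresentation.of_restrict_scalars_finitePresentation ℂ _ _

include Ψ hcomm in
theorem exists_opens_commutator :
    ∃ U : (affine E).Opens,
      (∀ v, pt v ∈ U ↔ AdSurjective (coordFst Φ v) ∨ AdSurjective (coordSnd Φ v)) ∧
      Smooth (U.ι ≫ affineMap c hc) ∧
      ∀ X : T,
        Smooth (((affineMap c hc).fiberι (pt X) ⁻¹ᵁ U).ι ≫
          (affineMap c hc).fiberToSpecResidueField (pt X)) ∧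
        2 ≤ codimension {x : (affineMap c hc).fiber (pt X) |
          (affineMap c hc).fiberι (pt X) x ∉ U} := by
  let S : Set (coordRing E) := regularFunctions (genericMatrix (coordFst Φ)) ∪
    regularFunctions (genericMatrix (coordSnd Φ))
  let U : (affine E).Opens := ⨆ f : S, (PrimeSpectrum.basicOpen f.1 : Opens (PrimeSpectrum _))
  have hU : ∀ x : PrimeSpectrum (coordRing E), x ∈ U.1 ↔ ∃ f ∈ S, f ∉ x.asIdeal := by
    intro x
    have : x ∈ U.1 ↔ ∃ f : S, f.1 ∉ x.asIdeal := Opens.mem_iSup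
    rw [this, Subtype.exists]
    simp only [exists_prop]
  have hUs : Smooth (U.ι ≫ affineMap c hc) := by
    have := locallyOfFinitePresentation_affineMap hc
    refine smooth_restrict_iSup _ _ fun f => smooth_basicOpen_ι_comp_affineMap hc ?_
    rcases f.2 with hf | hf
    · exact smooth_of_regularFunctions Φ Ψ hc hcomm hf
    · exact smooth_of_regularFunctions_coordSnd Φ Ψ hc hcomm hf
  refine ⟨U, fun v => ?_, hUs, fun X => ⟨smooth_fiber_of_smooth_restrict _ _ hUs _, ?_⟩⟩
  · refine (hU ⟨RingHom.ker (evalAt v), RingHom.ker_isPrime _⟩).trans ⟨?_, ?_⟩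
    · rintro ⟨f, hf | hf, hfv⟩
      · exact Or.inl (adSurjective_of_regularFunctions hf (evalAt v) hfv)
      · exact Or.inr (adSurjective_of_regularFunctions hf (evalAt v) hfv)
    · rintro (h | h)
      · obtain ⟨f, hf, hfv⟩ := exists_regularFunctions_ne_zero
          (genericMatrix_mem_symMatrix (coordFst_mem Φ)) (evalAt v) h
        exact ⟨f, Or.inl hf, hfv⟩
      · obtain ⟨f, hf, hfv⟩ := exists_regularFunctions_ne_zero
          (genericMatrix_mem_symMatrix (coordSnd_mem Φ)) (evalAt v) h
        exact ⟨f, Or.inr hf, hfv⟩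
  · have hrange : Set.range ((affineMap c hc).fiberι (pt X)) = _ :=
      ((affineMap c hc).range_fiberι (pt X)).trans (preimage_pt_eq_zeroLocus hc X)
    refine le_codimension (R := coordRing E) _ (j := (affineMap c hc).fiberι (pt X))
      ((affineMap c hc).fiberι (pt X)).isEmbedding.isInducing hrange fun y hy => ?_
    have hy' := (hU _).not.1 hy
    push Not at hy'
    let P : PrimeSpectrum (coordRing E) := (affineMap c hc).fiberι (pt X) y
    exact two_le_height_map Φ Ψ hc hcomm X P.asIdeal (hrange.le ⟨y, rfl⟩)
      (fun f hf => hy' f (Or.inl hf)) fun f hf => hy' f (Or.inr hf)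

end CommutatorMorphism

theorem finrank_ker_eq_iff_adSurjective {m : ℕ} (B : symMatrix (Fin m) ℂ)
    (f : symMatrix (Fin m) ℂ →ₗ[ℂ] skewMatrix (Fin m) ℂ)
    (hf : ∀ A, (f A : Matrix (Fin m) (Fin m) ℂ) = B * A - A * B) :
    Module.finrank ℂ (LinearMap.ker f) = m ↔ AdSurjective (B : Matrix (Fin m) (Fin m) ℂ) := by
  have h1 := f.finrank_range_add_finrank_ker
  have h2 := finrank_symMatrix (Fin m) ℂ
  rw [Fintype.card_fin] at h2
  have h3 : AdSurjective (B : Matrix (Fin m) (Fin m) ℂ) ↔ LinearMap.range f = ⊤ := by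
    rw [LinearMap.range_eq_top]
    refine ⟨fun h Z => ?_, fun h Z hZ => ?_⟩
    · obtain ⟨A, hA, hAZ⟩ := h Z Z.2
      exact ⟨⟨A, hA⟩, Subtype.ext ((hf _).trans hAZ)⟩
    · obtain ⟨A, hA⟩ := h ⟨Z, hZ⟩
      exact ⟨A, A.2, (hf A).symm.trans (congr_arg Subtype.val hA)⟩
  rw [h3]
  refine ⟨fun h => Submodule.eq_top_of_finrank_eq (by omega), fun h => ?_⟩
  rw [h, finrank_top] at h1
  omega

/-- The commutator with a symmetric matrix, from symmetric to skew-symmetric matrices. -/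
def symCommutator {m : ℕ} (B : symMatrix (Fin m) ℂ) :
    symMatrix (Fin m) ℂ →ₗ[ℂ] skewMatrix (Fin m) ℂ :=
  ((LinearMap.mulLeft ℂ (B : Matrix (Fin m) (Fin m) ℂ) -
    LinearMap.mulRight ℂ (B : Matrix (Fin m) (Fin m) ℂ)).restrict
      (p := symMatrix (Fin m) ℂ) (q := skewMatrix (Fin m) ℂ)
      fun _ hA => commutator_mem_skewMatrix B.2 hA)

section OrthonormalBasis

variable {V : Type u} [AddCommGroup V] [Module ℂ V] (b : LinearMap.BilinForm ℂ V) {m : ℕ}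
  (e : Module.Basis (Fin m) ℂ V) (he : ∀ i j, b (e i) (e j) = (1 : Matrix _ _ ℂ) i j)

include he in
theorem bilin_apply_basis_left (A : Module.End ℂ V) (i j : Fin m) :
    b (A (e j)) (e i) = LinearMap.toMatrix e e A i j := by
  rw [LinearMap.toMatrix_apply]
  generalize A (e j) = x
  conv_lhs => rw [← e.sum_repr x]
  rw [map_sum, LinearMap.sum_apply]
  simp only [map_smul, LinearMap.smul_apply, he, Matrix.one_apply]
  simp

include he in
theorem bilin_apply_basis_right (A : Module.End ℂ V) (i j : Fin m) :
    b (e i) (A (e j)) = LinearMap.toMatrix e e A i j := by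
  rw [LinearMap.toMatrix_apply]
  generalize A (e j) = x
  conv_lhs => rw [← e.sum_repr x]
  rw [map_sum]
  simp only [map_smul, he, Matrix.one_apply]
  simp

include he in
theorem mem_pSpace_iff_toMatrix_mem (A : Module.End ℂ V) :
    A ∈ pSpace b ↔ LinearMap.toMatrix e e A ∈ symMatrix (Fin m) ℂ := by
  rw [mem_symMatrix, LinearMap.mem_selfAdjointSubmodule]
  have h : LinearMap.IsSelfAdjoint b A ↔ ∀ x y, b (A x) y = b x (A y) := Iff.rfl
  refine h.trans ⟨fun h => ?_, fun h => ?_⟩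
  · ext i j
    rw [transpose_apply, ← bilin_apply_basis_left b e he, h, bilin_apply_basis_right b e he]
  · have h' : b.comp A LinearMap.id = b.comp LinearMap.id A := by
      refine LinearMap.BilinForm.ext_basis e fun i j => ?_
      change b (A (e i)) (e j) = b (e i) (A (e j))
      rw [bilin_apply_basis_left b e he, bilin_apply_basis_right b e he]
      exact congr_fun (congr_fun h i) j
    exact fun x y => congr_fun (congr_arg DFunLike.coe (LinearMap.congr_fun h' x)) y

include he in
theorem mem_tSpace_iff_toMatrix_mem (A : Module.End ℂ V) :
    A ∈ tSpace b ↔ LinearMap.toMatrix e e A ∈ skewMatrix (Fin m) ℂ := by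
  rw [mem_skewMatrix, LinearMap.mem_skewAdjointSubmodule]
  have h : LinearMap.IsSkewAdjoint b A ↔ ∀ x y, b (A x) y = b x (-A y) := Iff.rfl
  refine h.trans ⟨fun h => ?_, fun h => ?_⟩
  · ext i j
    rw [transpose_apply, ← bilin_apply_basis_left b e he, h, map_neg,
      bilin_apply_basis_right b e he]
    rfl
  · have h' : b.comp A LinearMap.id = b.comp LinearMap.id (-A) := by
      refine LinearMap.BilinForm.ext_basis e fun i j => ?_
      change b (A (e i)) (e j) = b (e i) (-A (e j))
      rw [map_neg, bilin_apply_basis_left b e he, bilin_apply_basis_right b e he]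
      exact congr_fun (congr_fun h i) j
    exact fun x y => congr_fun (congr_arg DFunLike.coe (LinearMap.congr_fun h' x)) y

/-- The matrix of a self-adjoint endomorphism in an orthonormal basis. -/
noncomputable def pSpaceEquiv : pSpace b ≃ₗ[ℂ] symMatrix (Fin m) ℂ :=
  (LinearMap.toMatrix e e).ofSubmodules _ _ <| by
    ext M
    rw [Submodule.mem_map_equiv, mem_pSpace_iff_toMatrix_mem b e he, LinearEquiv.apply_symm_apply]

/-- The matrix of a skew-adjoint endomorphism in an orthonormal basis. -/
noncomputable def tSpaceEquiv : tSpace b ≃ₗ[ℂ] skewMatrix (Fin m) ℂ :=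
  (LinearMap.toMatrix e e).ofSubmodules _ _ <| by
    ext M
    rw [Submodule.mem_map_equiv, mem_tSpace_iff_toMatrix_mem b e he, LinearEquiv.apply_symm_apply]

include he in
theorem mem_pStratum_iff_adSurjective (B : pSpace b) :
    B ∈ pStratum b m ↔ AdSurjective (LinearMap.toMatrix e e (B : Module.End ℂ V)) := by
  refine Iff.trans ?_ (finrank_ker_eq_iff_adSurjective (pSpaceEquiv b e he B)
    (symCommutator (pSpaceEquiv b e he B)) fun _ => rfl)
  have h : (pCentralizer b (B : Module.End ℂ V)).map
      (LinearMap.toMatrix e e : Module.End ℂ V →ₗ[ℂ] Matrix (Fin m) (Fin m) ℂ) =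
      (LinearMap.ker (symCommutator (pSpaceEquiv b e he B))).map
        (symMatrix (Fin m) ℂ).subtype := by
    ext M
    rw [Submodule.mem_map_equiv, Submodule.mem_map]
    have hM : M = LinearMap.toMatrix e e ((LinearMap.toMatrix e e).symm M) :=
      ((LinearMap.toMatrix e e).apply_symm_apply M).symm
    generalize (LinearMap.toMatrix e e).symm M = A at hM
    have hA : (A * (B : Module.End ℂ V) - B * A = 0) ↔
        LinearMap.toMatrix e e B * M - M * LinearMap.toMatrix e e B = 0 := by
      rw [hM, ← LinearMap.toMatrix_mul, ← LinearMap.toMatrix_mul, ← map_sub,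
        EmbeddingLike.map_eq_zero_iff, sub_eq_zero, sub_eq_zero, eq_comm]
    refine ⟨fun h => ⟨⟨M, ?_⟩, ?_, rfl⟩, ?_⟩
    · exact hM ▸ (mem_pSpace_iff_toMatrix_mem b e he A).1 h.1
    · exact Subtype.ext (hA.1 h.2)
    · rintro ⟨N, hN, rfl⟩
      refine ⟨(mem_pSpace_iff_toMatrix_mem b e he A).2 (hM ▸ N.2), hA.2 ?_⟩
      exact congr_arg Subtype.val hN
  rw [← Submodule.finrank_map_subtype_eq, ← h, LinearEquiv.finrank_map_eq]
  rfl

end OrthonormalBasis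

end OrthogonalCommutator

theorem mainTheorem9 {V : Type u} [AddCommGroup V] [Module ℂ V] [FiniteDimensional ℂ V]
    (b : LinearMap.BilinForm ℂ V) (hsymm : b.IsSymm) (hnd : b.Nondegenerate) :
    ∃ U : (OrthogonalCommutator.affine
        (OrthogonalCommutator.pSpace b × OrthogonalCommutator.pSpace b)).Opens,
      (∀ B₁ B₂ : OrthogonalCommutator.pSpace b,
        OrthogonalCommutator.pt (B₁, B₂) ∈ U ↔
          B₁ ∈ OrthogonalCommutator.pStratum b (Module.finrank ℂ V) ∨
          B₂ ∈ OrthogonalCommutator.pStratum b (Module.finrank ℂ V)) ∧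
      Smooth (U.ι ≫ OrthogonalCommutator.commutatorMor b) ∧
      ∀ X : OrthogonalCommutator.tSpace b,
        Smooth
          (((OrthogonalCommutator.commutatorMor b).fiberι (OrthogonalCommutator.pt X) ⁻¹ᵁ U).ι ≫
            (OrthogonalCommutator.commutatorMor b).fiberToSpecResidueField
              (OrthogonalCommutator.pt X)) ∧
        2 ≤ OrthogonalCommutator.codimension
          {x : (OrthogonalCommutator.commutatorMor b).fiber (OrthogonalCommutator.pt X) |
            (OrthogonalCommutator.commutatorMor b).fiberι (OrthogonalCommutator.pt X) x ∉ U} := by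
  obtain ⟨e, he⟩ := OrthogonalCommutator.exists_orthonormal_basis b hsymm hnd
  obtain ⟨U, hU, hU'⟩ := OrthogonalCommutator.exists_opens_commutator
    ((OrthogonalCommutator.pSpaceEquiv b e he).prodCongr
      (OrthogonalCommutator.pSpaceEquiv b e he))
    (OrthogonalCommutator.tSpaceEquiv b e he)
    (OrthogonalCommutator.isPolynomialMap_commutator b) fun x => by
      change LinearMap.toMatrix e e
        ((x.1 : Module.End ℂ V) * (x.2 : Module.End ℂ V) - x.2 * x.1) = _
      rw [map_sub, LinearMap.toMatrix_mul, LinearMap.toMatrix_mul]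
      rfl
  refine ⟨U, fun B₁ B₂ => (hU (B₁, B₂)).trans ?_, hU'⟩
  rw [OrthogonalCommutator.mem_pStratum_iff_adSurjective b e he,
    OrthogonalCommutator.mem_pStratum_iff_adSurjective b e he]
  rfl
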